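/- **Setting.** Let $\rho$ be a density operator and $O$ a Hermitian observable on $n$ qubits, and let $U(\vec\theta)=\prod_{l=1}^{M}V_l\,e^{-i\theta_{\mathcal S(l)}H_l}$ (the factor $l=1$ leftmost, $M\ge 1$) with fixed unitaries $V_l$, Hermitian generators $H_l$, parameters $\vec\theta\in\mathbb R^m$ and a surjection $\mathcal S:\{1,\dots,M\}\to\{1,\dots,m\}$. The loss is $\mathcal L(\vec\theta)=\mathrm{Tr}[U(\vec\theta)\rho U^\dagger(\vec\theta)O]$. Norms are operator norms. Write $O=\sum_i\lambda_i|\lambda_i\rangle\langle\lambda_i|$ with $\lambda_1\le\lambda_2\le\cdots$, $\Delta_{\rm gap}=\lambda_2-\lambda_1$, $\mathrm{Var}_\rho(H_M)=\mathrm{Tr}[\rho H_M^2]-\mathrm{Tr}[\rho H_M]^2$, $\omega_q=\sum_{l\in\mathcal S^{-1}(q)}(\lambda_{\max}(H_l)-\lambda_{\min}(H_l))$, and $p=\mathcal S(M)$, the parameter of the generator $H_M$ closest to the input state. $\mathrm{Var}_{r}$ denotes the variance for $\vec\theta$ uniform on the hypercube $\prod_i[\theta^*_i-r,\theta^*_i+r]$.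 **Assumptions.** $\vec\theta^*$ is a (local or global) minimum of $\mathcal L$; $\lambda_1<\lambda_2$; $\langle\lambda_1|U(\vec\theta^*)\rho U^\dagger(\vec\theta^*)|\lambda_1\rangle=1-|\epsilon|^2$; $\mathcal S(l)=p$ only for $l=M$; and $$|\epsilon|<T:=\frac{\Delta_{\rm gap}\mathrm{Var}_\rho(H_M)}{(6\|O\|+11\Delta_{\rm gap})\|H_M\|^2}.$$ **Patch.** Put $A=\Delta_{\rm gap}\mathrm{Var}_\rho(H_M)-|\epsilon|\,\|H_M\|^2(11\Delta_{\rm gap}+6\|O\|)$ and $$(r^*_{\rm patch})^2=\frac{9A^2}{128\,\|O\|^2\,\omega_p^4\,\max\{\sum_{j\ne p}\omega_j^2,\ \omega_p^2/2\}} .$$ **(1)** Then $A>0$, $r^*_{\rm patch}>0$, and for every $0<r\le r^*_{\rm patch}$, in particular for $r=r^*_{\rm patch}$, $$\mathrm{Var}_{r}[\mathcal L]\ \ge\ \frac{A^2}{18}\,r^4 .$$ **(2)** Consider a sequence of such problems, one for each number of qubits $n$ (the assumptions holding for all large $n$), with $\Delta_{\rm gap},\mathrm{Var}_\rho(H_M)\in\Omega(1/\mathrm{poly}(n))$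 and $\|O\|,\max_q\omega_q\in O(\mathrm{poly}(n))$. (a) There are $a>0$ and $k\in\mathbb N$ such that, if $m\in O(\mathrm{poly}(n))$, the patch of half-width $r_n=a/(\sqrt m\,n^k)$ around $\vec\theta^*$ has $\mathrm{Var}_{r_n}[\mathcal L]\in\Omega(1/(\sqrt m\,\mathrm{poly}(n)))$. (b) If moreover $|\epsilon|\le(1-\delta_n)T$ for some $\delta_n\in\Omega(1/\mathrm{poly}(n))$, then $r^*_{\rm patch}\in\Omega(1/(\sqrt m\,\mathrm{poly}(n)))$, and if $m\in O(\mathrm{poly}(n))$, then $\mathrm{Var}_{r^*_{\rm patch}}[\mathcal L]\in\Omega(1/(\sqrt m\,\mathrm{poly}(n)))$. -/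

import Mathlib

open Filter MeasureTheory ProbabilityTheory
open scoped Matrix Matrix.Norms.L2Operator ComplexOrder

noncomputable section

/-- Operators on `n` qubits: complex `2 ^ n × 2 ^ n` matrices. The norm `‖A‖` is the operator norm
(largest singular value). -/
abbrev QOp (n : ℕ) : Type := Matrix (Fin (2 ^ n)) (Fin (2 ^ n)) ℂ

/-- A variational problem on `n` qubits with `m` independent parameters and `M = K + 1` gates
(at least one gate): the parameter assignment `S`, the fixed unitaries `V l`, the Hermitian
generators `H l`, the input state `ρ` and the observable `O`. The gate with index `0` is closest to
the observable, the gate with index `Fin.last K` is closest to the input state. -/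
structure VarProblem (n m K : ℕ) where
  S : Fin (K + 1) → Fin m
  S_surj : Function.Surjective S
  V : Fin (K + 1) → Matrix.unitaryGroup (Fin (2 ^ n)) ℂ
  H : Fin (K + 1) → QOp n
  H_herm : ∀ l, (H l).IsHermitian
  ρ : QOp n
  ρ_psd : ρ.PosSemidef
  ρ_trace : ρ.trace = 1
  O : QOp n
  O_herm : O.IsHermitian

namespace VarProblem

variable {n m K : ℕ} (P : VarProblem n m K)

/-- The gate `V_l exp(-i t H_l)`. -/
def gate (l : Fin (K + 1)) (t : ℝ) : QOp n :=
  (P.V l : QOp n) * NormedSpace.exp ((-(Complex.I * (t : ℂ))) • P.H l)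

/-- The circuit `U(θ) = ∏_l V_l exp(-i θ_{S(l)} H_l)`, the factor `l = 0` standing leftmost. -/
def circuit (θ : Fin m → ℝ) : QOp n :=
  (List.ofFn fun l : Fin (K + 1) => P.gate l (θ (P.S l))).prod

/-- The evolved state `U(θ) ρ U(θ)†`. -/
def evolved (θ : Fin m → ℝ) : QOp n := P.circuit θ * P.ρ * (P.circuit θ)ᴴ

/-- The loss `Tr[U(θ) ρ U(θ)† O]`, which is a real number. -/
def loss (θ : Fin m → ℝ) : ℝ := (P.evolved θ * P.O).trace.re

/-- The generator closest to the input state. -/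
def lastH : QOp n := P.H (Fin.last K)

/-- The parameter of the generator closest to the input state. -/
def lastParam : Fin m := P.S (Fin.last K)

/-- `Var_ρ(H_M) = Tr[ρ H_M²] - Tr[ρ H_M]²`. -/
def stateVar : ℝ :=
  (P.ρ * (P.lastH * P.lastH)).trace.re - (P.ρ * P.lastH).trace.re ^ 2

/-- `λ_max(H_l) - λ_min(H_l)`. -/
def gateFreq (l : Fin (K + 1)) : ℝ :=
  (⨆ i, (P.H_herm l).eigenvalues i) - (⨅ i, (P.H_herm l).eigenvalues i)

/-- The maximal frequency of the parameter `q`: the sum of the maximal frequencies of the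
generators that carry this parameter. -/
def maxFreq (q : Fin m) : ℝ :=
  ∑ l ∈ Finset.univ.filter (fun l => P.S l = q), P.gateFreq l

/-- The variance of the loss for `θ` uniform on the hypercube of width `2 r` centred at `φ`. -/
def patchVar (φ : Fin m → ℝ) (r : ℝ) : ℝ :=
  variance P.loss
    (cond (volume : Measure (Fin m → ℝ)) (Set.Icc (fun i => φ i - r) (fun i => φ i + r)))

end VarProblem

/-- An eigendecomposition `O = ∑ i, lam i |v i⟩⟨v i|` with eigenvalues in increasing order. -/
structure EigenDecomp {n : ℕ} (O : QOp n) where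
  lam : Fin (2 ^ n) → ℝ
  lam_mono : Monotone lam
  v : OrthonormalBasis (Fin (2 ^ n)) ℂ (EuclideanSpace ℂ (Fin (2 ^ n)))
  eigen : ∀ i, Matrix.toEuclideanLin O (v i) = (lam i : ℂ) • v i

namespace EigenDecomp

variable {n : ℕ} {O : QOp n} (E : EigenDecomp O)

/-- The gap between the two lowest eigenvalues, counted with multiplicity. -/
def gap : ℝ := E.lam 1 - E.lam 0

/-- The rank one projection on the ground state. -/
def groundProj : QOp n := Matrix.vecMulVec (E.v 0).ofLp (star (E.v 0).ofLp)

end EigenDecomp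

namespace VarProblem

variable {n m K : ℕ} (P : VarProblem n m K)

/-- The bound that `|ε|` has to stay below. -/
def threshold (E : EigenDecomp P.O) : ℝ :=
  E.gap * P.stateVar / ((6 * ‖P.O‖ + 11 * E.gap) * ‖P.lastH‖ ^ 2)

/-- `Δ_gap Var_ρ(H_M) - |ε| ‖H_M‖² (11 Δ_gap + 6 ‖O‖)`. -/
def curv (E : EigenDecomp P.O) (ε : ℂ) : ℝ :=
  E.gap * P.stateVar - ‖ε‖ * ‖P.lastH‖ ^ 2 * (11 * E.gap + 6 * ‖P.O‖)

/-- The explicit half-width of the patch. -/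
def rStar (E : EigenDecomp P.O) (ε : ℂ) : ℝ :=
  √(9 * P.curv E ε ^ 2 /
    (128 * ‖P.O‖ ^ 2 * P.maxFreq P.lastParam ^ 4 *
      max (∑ j ∈ Finset.univ.erase P.lastParam, P.maxFreq j ^ 2)
        (P.maxFreq P.lastParam ^ 2 / 2)))

/-- The standing assumptions on a minimum `θ` of the loss. -/
structure GoodMinimum (E : EigenDecomp P.O) (θ : Fin m → ℝ) (ε : ℂ) : Prop where
  /-- `θ` is a minimum (possibly only a local one) of the loss. -/
  isMin : IsLocalMin P.loss θ
  /-- The ground state is non-degenerate. -/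
  nondeg : E.lam 0 < E.lam 1
  /-- The fidelity of the output state with the ground state is `1 - |ε|²`. -/
  fidelity : (P.evolved θ * E.groundProj).trace = ((1 - ‖ε‖ ^ 2 : ℝ) : ℂ)
  /-- The parameter of the last generator drives no other generator. -/
  uncorrelated : ∀ l, P.S l = P.lastParam → l = Fin.last K
  /-- The infidelity is small. -/
  small : ‖ε‖ < P.threshold E

end VarProblem

/-- `f ∈ O(poly(n))`, for nonnegative `f`. -/
def InOPoly (f : ℕ → ℝ) : Prop :=
  ∃ c : ℝ, 0 < c ∧ ∃ k : ℕ, ∀ᶠ n : ℕ in atTop, f n ≤ c * (n : ℝ) ^ k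

/-- `f ∈ Ω(1 / (g · poly(n)))`, for positive `g`. -/
def InOmegaInvPoly (g f : ℕ → ℝ) : Prop :=
  ∃ c : ℝ, 0 < c ∧ ∃ k : ℕ, ∀ᶠ n : ℕ in atTop, c / (g n * (n : ℝ) ^ k) ≤ f n

end

/-!
Pulled back through the circuit, the observable is a function of each parameter `θ_j` with
Bernstein bounds `‖∂_j ^ k‖ ≤ ‖O‖ ω_j ^ k`. The second derivative of the loss in the last parameter
is the expectation of the double commutator of `H_M` with the pulled-back observable; near the
ground state it is `2 Δ_gap Var_ρ(H_M)` up to an error `O(|ε|)`, hence positive.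

The variance of the loss is bounded below by Cauchy–Schwarz against the test function
`(θ_p - θ*_p) ^ 2`. Reflecting `θ_p` about `θ*_p` removes the odd Taylor terms from this covariance.
What remains is the variance of the test function times half the second derivative, minus a fourth
order remainder. Reflecting the other parameters in the same way, the second derivative at `θ*`
changes only at second order when it is averaged over the patch, which is where
`∑_{j ≠ p} ω_j ^ 2` enters the half-width.
-/

open scoped ContDiff

section Evolution

variable {A : Type*} [CStarAlgebra A]

/-- The derivation `i [H, ·]`, which generates the evolution of observables under `H`. -/
noncomputable def liouvillian (H : A) : A →L[ℝ] A :=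
  Complex.I • (ContinuousLinearMap.mul ℝ A H - (ContinuousLinearMap.mul ℝ A).flip H)

theorem liouvillian_apply (H X : A) : liouvillian H X = Complex.I • (H * X - X * H) := rfl

theorem liouvillian_liouvillian (H X : A) :
    liouvillian H (liouvillian H X) = 2 • (H * X * H) - H * H * X - X * (H * H) := by
  simp only [liouvillian_apply, mul_smul_comm, smul_mul_assoc, ← smul_sub, smul_smul,
    Complex.I_mul_I, neg_one_smul]
  noncomm_ring

theorem liouvillian_sub_smul_one (H : A) (c : ℂ) : liouvillian (H - c • 1) = liouvillian H := by
  ext X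
  simp only [liouvillian_apply, sub_mul, mul_sub, smul_mul_assoc, mul_smul_comm, one_mul, mul_one,
    sub_sub_sub_cancel_right]

theorem liouvillian_smul_one (H : A) (c : ℂ) : liouvillian H (c • 1) = 0 := by
  rw [liouvillian_apply, mul_smul_comm, smul_mul_assoc, mul_one, one_mul, sub_self, smul_zero]

theorem norm_liouvillian_apply_le (H : A) (c : ℂ) (X : A) :
    ‖liouvillian H X‖ ≤ 2 * ‖H - c • 1‖ * ‖X‖ := by
  rw [← liouvillian_sub_smul_one H c, liouvillian_apply, norm_smul, Complex.norm_I, one_mul]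
  linarith [norm_sub_le ((H - c • 1) * X) (X * (H - c • 1)), norm_mul_le (H - c • 1) X,
    norm_mul_le X (H - c • 1)]

/-- The unitary group `exp (-i t H)` generated by the Hamiltonian `H`. -/
noncomputable def evolution (H : A) (t : ℝ) : A :=
  NormedSpace.exp ((-(Complex.I * (t : ℂ))) • H)

theorem evolution_eq_exp_smul (H : A) (t : ℝ) :
    evolution H t = NormedSpace.exp (t • ((-Complex.I) • H)) := by
  rw [evolution, ← Complex.coe_smul, smul_smul]
  congr 2
  ring

theorem evolution_zero (H : A) : evolution H 0 = 1 := by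
  rw [evolution_eq_exp_smul, zero_smul, NormedSpace.exp_zero]

theorem evolution_add (H : A) (s t : ℝ) :
    evolution H (s + t) = evolution H s * evolution H t := by
  let : NormedAlgebra ℚ A := .restrictScalars ℚ ℝ A
  simp only [evolution_eq_exp_smul, add_smul]
  exact NormedSpace.exp_add_of_commute (((Commute.refl _).smul_left s).smul_right t)

theorem star_evolution {H : A} (hH : IsSelfAdjoint H) (t : ℝ) :
    star (evolution H t) = evolution H (-t) := by
  rw [evolution, NormedSpace.star_exp, star_smul, hH.star_eq, evolution]
  simp only [star_neg, star_mul', Complex.star_def, Complex.conj_I, Complex.conj_ofReal,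
    Complex.ofReal_neg, neg_mul, mul_neg]

theorem evolution_mem_unitary {H : A} (hH : IsSelfAdjoint H) (t : ℝ) :
    evolution H t ∈ unitary A := by
  rw [Unitary.mem_iff, star_evolution hH, ← evolution_add, ← evolution_add, neg_add_cancel,
    add_neg_cancel, evolution_zero]
  exact ⟨rfl, rfl⟩

theorem hasDerivAt_evolution (H : A) (t : ℝ) :
    HasDerivAt (evolution H) (-Complex.I • H * evolution H t) t := by
  rw [funext (evolution_eq_exp_smul H)]
  exact hasDerivAt_exp_smul_const' (-Complex.I • H) t

theorem contDiff_evolution (H : A) : ContDiff ℝ ∞ (evolution H) := by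
  have hexp : ContDiff ℝ ∞ (NormedSpace.exp : A → A) :=
    contDiff_iff_contDiffAt.2 fun X => (NormedSpace.exp_analytic (𝕂 := ℝ) X).contDiffAt
  rw [funext (evolution_eq_exp_smul H)]
  exact hexp.comp (contDiff_id.smul contDiff_const)

theorem norm_star_mul_mul_of_mem_unitary {U : A} (hU : U ∈ unitary A) (X : A) :
    ‖star U * X * U‖ = ‖X‖ := by
  rw [CStarRing.norm_mul_mem_unitary _ hU, CStarRing.norm_mem_unitary_mul _ (Unitary.star_mem hU)]

/-- The Heisenberg equation. -/
theorem hasDerivAt_star_evolution_mul_mul {H : A} (hH : IsSelfAdjoint H) {Y : ℝ → A}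
    {Y' : A} {t : ℝ} (hY : HasDerivAt Y Y' t) :
    HasDerivAt (fun t => star (evolution H t) * Y t * evolution H t)
      (star (evolution H t) * (Y' + liouvillian H (Y t)) * evolution H t) t := by
  have hU := hasDerivAt_evolution H t
  have hUstar : HasDerivAt (fun t => star (evolution H t)) _ t := hU.star
  refine ((hUstar.mul hY).mul hU).congr_deriv ?_
  rw [star_mul, star_smul, hH.star_eq, star_neg, Complex.star_def, Complex.conj_I, neg_neg,
    liouvillian_apply]
  simp only [smul_mul_assoc, mul_smul_comm, neg_smul, mul_add, add_mul, mul_sub, sub_mul, smul_sub,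
    mul_assoc, neg_mul, mul_neg, Pi.mul_apply]
  abel

theorem iteratedDeriv_two_conj_evolution {F : Type*} [NormedAddCommGroup F] [NormedSpace ℝ F]
    {H : A} (hH : IsSelfAdjoint H) (X : A) (f : A →L[ℝ] F) :
    iteratedDeriv 2 (fun t => f (star (evolution H t) * X * evolution H t)) 0 =
      f (liouvillian H (liouvillian H X)) := by
  have heisenberg : ∀ X : A, deriv (fun t => f (star (evolution H t) * X * evolution H t)) =
      fun t => f (star (evolution H t) * liouvillian H X * evolution H t) := fun X =>
    funext fun t => by
      have h := hasDerivAt_star_evolution_mul_mul hH (hasDerivAt_const t X)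
      rw [zero_add] at h
      exact (f.hasFDerivAt.comp_hasDerivAt t h).deriv
  rw [iteratedDeriv_succ, iteratedDeriv_one, heisenberg, heisenberg]
  simp only [evolution_zero, star_one, one_mul, mul_one]

end Evolution

section BandLimited

variable {F G : Type*} [NormedAddCommGroup F] [NormedSpace ℝ F] [NormedAddCommGroup G]
  [NormedSpace ℝ G] {c d w v : ℝ} {Y Z : ℝ → F}

/-- Bernstein-type derivative bounds, as satisfied by a trigonometric polynomial of amplitude `c`
whose frequencies are at most `w`. -/
structure BandLimited (c w : ℝ) (Y : ℝ → F) : Prop where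
  contDiff : ContDiff ℝ ∞ Y
  norm_iteratedDeriv_le (k : ℕ) (t : ℝ) : ‖iteratedDeriv k Y t‖ ≤ c * w ^ k

namespace BandLimited

theorem norm_le (h : BandLimited c w Y) (t : ℝ) : ‖Y t‖ ≤ c := by
  simpa using h.norm_iteratedDeriv_le 0 t

theorem const (Y : F) : BandLimited ‖Y‖ 0 fun _ : ℝ => Y where
  contDiff := contDiff_const
  norm_iteratedDeriv_le k t := by
    rw [iteratedDeriv_const]
    rcases k with - | k <;> simp

theorem deriv (h : BandLimited c w Y) : BandLimited (c * w) w (deriv Y) where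
  contDiff := (contDiff_infty_iff_deriv.1 h.contDiff).2
  norm_iteratedDeriv_le k t := by
    rw [← iteratedDeriv_succ', mul_assoc, ← pow_succ']
    exact h.norm_iteratedDeriv_le (k + 1) t

theorem add (hY : BandLimited c w Y) (hZ : BandLimited d w Z) :
    BandLimited (c + d) w fun t => Y t + Z t where
  contDiff := hY.contDiff.add hZ.contDiff
  norm_iteratedDeriv_le k t := by
    rw [iteratedDeriv_fun_add (hY.contDiff.contDiffAt.of_le (by exact_mod_cast le_top))
      (hZ.contDiff.contDiffAt.of_le (by exact_mod_cast le_top)), add_mul]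
    exact (norm_add_le _ _).trans
      (add_le_add (hY.norm_iteratedDeriv_le k t) (hZ.norm_iteratedDeriv_le k t))

theorem clm_comp (h : BandLimited c w Y) (f : F →L[ℝ] G) (hf : ∀ x, ‖f x‖ ≤ v * ‖x‖)
    (hv : 0 ≤ v) : BandLimited (v * c) w fun t => f (Y t) where
  contDiff := f.contDiff.comp h.contDiff
  norm_iteratedDeriv_le k t := by
    have commute : iteratedDeriv k (fun t => f (Y t)) t = f (iteratedDeriv k Y t) := by
      simp only [iteratedDeriv_eq_iteratedFDeriv]
      exact DFunLike.congr_fun (f.iteratedFDeriv_comp_left h.contDiff.contDiffAt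
        (by exact_mod_cast le_top)) _
    rw [commute, mul_assoc]
    exact (hf _).trans (mul_le_mul_of_nonneg_left (h.norm_iteratedDeriv_le k t) hv)

theorem clm_comp_of_contraction (h : BandLimited c w Y) (f : F →L[ℝ] G) (hf : ∀ x, ‖f x‖ ≤ ‖x‖) :
    BandLimited c w fun t => f (Y t) := by
  simpa only [one_mul] using h.clm_comp f (v := 1) (by simpa only [one_mul]) zero_le_one

section Conj

variable {A : Type*} [CStarAlgebra A] {X : ℝ → A}

theorem conj_unitary (h : BandLimited c w X) {U : A} (hU : U ∈ unitary A) :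
    BandLimited c w fun t => star U * X t * U :=
  h.clm_comp_of_contraction
    ((ContinuousLinearMap.mul ℝ A).flip U ∘L ContinuousLinearMap.mul ℝ A (star U))
    fun X => (norm_star_mul_mul_of_mem_unitary hU X).le

theorem conj_evolution (h : BandLimited c w X) {H : A} (hH : IsSelfAdjoint H)
    (hv : ∀ X, ‖liouvillian H X‖ ≤ v * ‖X‖) (hv₀ : 0 ≤ v) :
    BandLimited c (w + v) fun t => star (evolution H t) * X t * evolution H t where
  contDiff := by
    have hU := contDiff_evolution H
    have hUstar : ContDiff ℝ ∞ fun t => star (evolution H t) := by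
      simp only [star_evolution hH]
      exact hU.comp contDiff_neg
    exact (hUstar.mul h.contDiff).mul hU
  norm_iteratedDeriv_le k t := by
    induction k generalizing c X with
    | zero =>
      rw [iteratedDeriv_zero, pow_zero, mul_one, norm_star_mul_mul_of_mem_unitary
        (evolution_mem_unitary hH t)]
      exact h.norm_le t
    | succ k ih =>
      have hX : ∀ t, HasDerivAt X (_root_.deriv X t) t := fun t =>
        (h.contDiff.differentiable (by simp) t).hasDerivAt
      rw [iteratedDeriv_succ', funext fun t => (hasDerivAt_star_evolution_mul_mul hH (hX t)).deriv]
      refine (ih (h.deriv.add (h.clm_comp (liouvillian H) hv hv₀))).trans_eq ?_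
      ring

theorem conj_list_prod {g : ℕ} {U : Fin g → ℝ → A} {v : Fin g → ℝ}
    (hU : ∀ l c w X, BandLimited c w X →
      BandLimited c (w + v l) fun t => star (U l t) * X t * U l t)
    (h : BandLimited c w X) :
    BandLimited c (w + ∑ l, v l) fun t =>
      star (List.ofFn fun l => U l t).prod * X t * (List.ofFn fun l => U l t).prod := by
  induction g generalizing w X with
  | zero => simpa using h
  | succ g ih =>
    have htail := ih (fun l => hU l.succ) (hU 0 c w X h)
    rw [Fin.sum_univ_succ, ← add_assoc]
    simpa only [List.ofFn_succ, List.prod_cons, star_mul, mul_assoc] using htail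

end Conj

theorem abs_sub_taylor_le {f : ℝ → ℝ} (h : BandLimited c w f) (n : ℕ) (t : ℝ) :
    |f t - ∑ k ∈ Finset.range (n + 1), iteratedDeriv k f 0 * t ^ k / k.factorial| ≤
      c * w ^ (n + 1) * |t| ^ (n + 1) / (n + 1).factorial := by
  rcases eq_or_ne t 0 with rfl | ht
  · simp [Finset.sum_range_succ']
  obtain ⟨s, -, hs⟩ := taylor_mean_remainder_lagrange_iteratedDeriv ht.symm
    (h.contDiff.contDiffOn.of_le (by exact_mod_cast le_top))
  rw [taylor_within_apply] at hs
  have coeff : ∀ k, iteratedDerivWithin k f (Set.uIcc 0 t) 0 = iteratedDeriv k f 0 := fun k =>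
    iteratedDerivWithin_eq_iteratedDeriv (uniqueDiffOn_uIcc ht.symm)
      (h.contDiff.contDiffAt.of_le (by exact_mod_cast le_top)) Set.left_mem_uIcc
  simp only [coeff, sub_zero, smul_eq_mul] at hs
  have remainder :
      f t - ∑ k ∈ Finset.range (n + 1), iteratedDeriv k f 0 * t ^ k / k.factorial = _ :=
    (congrArg (f t - ·) (Finset.sum_congr rfl fun k _ => by ring)).trans hs
  rw [remainder, abs_div, abs_mul, abs_pow, Nat.abs_cast]
  gcongr
  exact h.norm_iteratedDeriv_le (n + 1) s

theorem abs_second_difference_le {f : ℝ → ℝ} (h : BandLimited c w f) (t : ℝ) :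
    |f t + f (-t) - 2 * f 0| ≤ c * w ^ 2 * t ^ 2 := by
  have hpos := abs_le.1 (h.abs_sub_taylor_le 1 t)
  have hneg := abs_le.1 (h.abs_sub_taylor_le 1 (-t))
  simp only [Finset.sum_range_succ, Finset.sum_range_zero, iteratedDeriv_zero, Nat.factorial,
    abs_neg, Even.pow_abs even_two, Nat.reduceAdd] at hpos hneg
  rw [abs_le]
  constructor <;> linarith

theorem abs_second_difference_sub_le {f : ℝ → ℝ} (h : BandLimited c w f) (t : ℝ) :
    |f t + f (-t) - 2 * f 0 - t ^ 2 * iteratedDeriv 2 f 0| ≤ c * w ^ 4 / 12 * t ^ 4 := by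
  have hpos := abs_le.1 (h.abs_sub_taylor_le 3 t)
  have hneg := abs_le.1 (h.abs_sub_taylor_le 3 (-t))
  simp only [Finset.sum_range_succ, Finset.sum_range_zero, iteratedDeriv_zero, Nat.factorial,
    abs_neg, Even.pow_abs (show Even 4 by decide), Nat.reduceAdd] at hpos hneg
  rw [abs_le]
  constructor <;> linarith

end BandLimited

end BandLimited

section State

variable {A : Type*} [CStarAlgebra A] [PartialOrder A]

theorem norm_sq_map_star_mul_le [StarOrderedRing A] (φ : A →ₚ[ℂ] ℂ) (X Y : A) :
    ‖φ (star X * Y)‖ ^ 2 ≤ (φ (star X * X)).re * (φ (star Y * Y)).re := by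
  have norm_sq : ∀ Z : A, (φ (star Z * Z)).re = ‖φ.toPreGNS Z‖ ^ 2 := fun Z =>
    (congrArg Complex.re (φ.preGNS_norm_sq (φ.toPreGNS Z))).symm.trans (by norm_cast)
  rw [norm_sq, norm_sq, ← mul_pow]
  gcongr
  exact norm_inner_le_norm (𝕜 := ℂ) (φ.toPreGNS X) (φ.toPreGNS Y)

theorem mul_sub_le_re_map_conj [StarOrderedRing A] (φ : A →ₚ[ℂ] ℂ) {H O P : A} {g : ℝ}
    (hH : IsSelfAdjoint H) (hgap : g • (1 - P) ≤ O) :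
    g * ((φ (H * H)).re - (φ (H * P * H)).re) ≤ (φ (H * O * H)).re := by
  have h := (Complex.le_def.1 (OrderHomClass.mono φ (hH.conjugate_le_conjugate hgap))).1
  rwa [← Complex.coe_smul, mul_smul_comm, smul_mul_assoc, mul_sub, sub_mul, mul_one, map_smul,
    smul_eq_mul, Complex.re_ofReal_mul, map_sub, Complex.sub_re] at h

/-- A positive functional on a C⋆-algebra is a state when it is normalised; `φ X` is then the
expectation of the observable `X`. -/
structure IsState (φ : A →ₚ[ℂ] ℂ) : Prop where
  map_one : φ 1 = 1

namespace IsState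

variable {φ : A →ₚ[ℂ] ℂ} {P : A} {e : ℝ}

theorem re_map_one_sub (hφ : IsState φ) (hP : (φ P).re = 1 - e ^ 2) :
    (φ (1 - P)).re = e ^ 2 := by
  rw [map_sub, hφ.map_one, Complex.sub_re, Complex.one_re, hP, sub_sub_cancel]

variable [StarOrderedRing A]

theorem re_map_star_mul_self_le (hφ : IsState φ) (X : A) : (φ (star X * X)).re ≤ ‖X‖ ^ 2 := by
  have h := φ.norm_apply_le_of_nonneg _ (star_mul_self_nonneg X)
  rw [hφ.map_one, norm_one, one_mul, CStarRing.norm_star_mul_self, ← sq] at h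
  exact (Complex.re_le_norm _).trans h

theorem norm_map_le (hφ : IsState φ) (X : A) : ‖φ X‖ ≤ ‖X‖ := by
  have h := norm_sq_map_star_mul_le φ 1 X
  rw [star_one, one_mul, one_mul, hφ.map_one, Complex.one_re, one_mul] at h
  exact le_of_sq_le_sq (h.trans (hφ.re_map_star_mul_self_le X)) (norm_nonneg X)

section Projection

variable {Q : A}

theorem abs_re_map_mul_projection_le (hφ : IsState φ) (hQ : IsStarProjection Q) (he : 0 ≤ e)
    (hQe : (φ Q).re = e ^ 2) (X : A) : |(φ (X * Q)).re| ≤ ‖X‖ * e := by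
  have h := norm_sq_map_star_mul_le φ (star X) Q
  have hX := hφ.re_map_star_mul_self_le (star X)
  rw [hQ.isSelfAdjoint.star_eq, hQ.isIdempotentElem.eq, hQe, star_star] at h
  rw [norm_star, star_star] at hX
  refine (Complex.abs_re_le_norm _).trans (le_of_sq_le_sq ?_ (by positivity))
  exact h.trans (by rw [mul_pow]; gcongr)

theorem abs_re_map_projection_mul_le (hφ : IsState φ) (hQ : IsStarProjection Q) (he : 0 ≤ e)
    (hQe : (φ Q).re = e ^ 2) (X : A) : |(φ (Q * X)).re| ≤ ‖X‖ * e := by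
  have h := hφ.abs_re_map_mul_projection_le hQ he hQe (star X)
  have hstar : φ (star X * Q) = star (φ (Q * X)) := by
    rw [← map_star φ, star_mul, hQ.isSelfAdjoint.star_eq]
  rwa [hstar, Complex.star_def, Complex.conj_re, norm_star] at h

theorem abs_re_map_sub_compression_le (hφ : IsState φ) (hP : IsStarProjection P) (he : 0 ≤ e)
    (hPe : (φ P).re = 1 - e ^ 2) (X : A) :
    |(φ X).re - (φ (P * X * P)).re| ≤ 2 * ‖X‖ * e := by
  have hQe := hφ.re_map_one_sub hPe
  have hPX : ‖P * X‖ ≤ ‖X‖ := (norm_mul_le _ _).trans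
    (mul_le_of_le_one_left (norm_nonneg X) (IsStarProjection.norm_le P hP))
  have right := (hφ.abs_re_map_mul_projection_le hP.one_sub he hQe (P * X)).trans
    (mul_le_mul_of_nonneg_right hPX he)
  have left := hφ.abs_re_map_projection_mul_le hP.one_sub he hQe X
  have split : X - P * X * P = P * X * (1 - P) + (1 - P) * X := by noncomm_ring
  rw [← Complex.sub_re, ← map_sub, split, map_add, Complex.add_re]
  linarith [abs_add_le (φ (P * X * (1 - P))).re (φ ((1 - P) * X)).re]

theorem abs_re_map_mul_le_of_mul_projection_eq_zero (hφ : IsState φ) (hP : IsStarProjection P)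
    (he : 0 ≤ e) (hPe : (φ P).re = 1 - e ^ 2) {O : A} (hOP : O * P = 0) (X : A) :
    |(φ (X * O)).re| ≤ ‖X‖ * ‖O‖ * e := by
  have factor : X * O = X * O * (1 - P) := by
    rw [mul_sub, mul_one, mul_assoc X O P, hOP, mul_zero, sub_zero]
  rw [factor]
  exact (hφ.abs_re_map_mul_projection_le hP.one_sub he (hφ.re_map_one_sub hPe) _).trans
    (mul_le_mul_of_nonneg_right (norm_mul_le _ _) he)

theorem abs_re_map_mul_le_of_projection_mul_eq_zero (hφ : IsState φ) (hP : IsStarProjection P)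
    (he : 0 ≤ e) (hPe : (φ P).re = 1 - e ^ 2) {O : A} (hPO : P * O = 0) (X : A) :
    |(φ (O * X)).re| ≤ ‖O‖ * ‖X‖ * e := by
  have factor : O * X = (1 - P) * (O * X) := by
    rw [sub_mul, one_mul, ← mul_assoc P O X, hPO, zero_mul, sub_zero]
  rw [factor]
  exact (hφ.abs_re_map_projection_mul_le hP.one_sub he (hφ.re_map_one_sub hPe) _).trans
    (mul_le_mul_of_nonneg_right (norm_mul_le _ _) he)

end Projection

variable {H : A} {a : ℝ}

theorem re_map_mul_projection_mul_le (hφ : IsState φ) (hP : IsStarProjection P) (he : 0 ≤ e)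
    (hPe : (φ P).re = 1 - e ^ 2) (hPHP : P * H * P = (a : ℂ) • P) :
    (φ (H * P * H)).re ≤ a ^ 2 + 2 * ‖H‖ ^ 2 * e := by
  have hn : ‖H * P * H‖ ≤ ‖H‖ ^ 2 := calc
    ‖H * P * H‖ ≤ ‖H‖ * ‖P‖ * ‖H‖ := norm_mul₃_le
    _ ≤ ‖H‖ * 1 * ‖H‖ := by gcongr; exact IsStarProjection.norm_le P hP
    _ = ‖H‖ ^ 2 := by ring
  have compress : P * (H * P * H) * P = ((a ^ 2 : ℝ) : ℂ) • P := calc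
    P * (H * P * H) * P = P * H * (P * P) * H * P := by
      rw [hP.isIdempotentElem.eq]; simp only [mul_assoc]
    _ = (P * H * P) * (P * H * P) := by simp only [mul_assoc]
    _ = ((a ^ 2 : ℝ) : ℂ) • P := by
      rw [hPHP, smul_mul_smul_comm, hP.isIdempotentElem.eq, ← sq, Complex.ofReal_pow]
  have h := hφ.abs_re_map_sub_compression_le hP he hPe (H * P * H)
  rw [compress, map_smul, smul_eq_mul, Complex.re_ofReal_mul, hPe] at h
  have : 2 * ‖H * P * H‖ * e ≤ 2 * ‖H‖ ^ 2 * e := by gcongr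
  linarith [le_abs_self ((φ (H * P * H)).re - a ^ 2 * (1 - e ^ 2)),
    mul_nonneg (sq_nonneg a) (sq_nonneg e)]

theorem sq_sub_le_sq_re_map (hφ : IsState φ) (hP : IsStarProjection P) (he : 0 ≤ e)
    (hPe : (φ P).re = 1 - e ^ 2) (hPHP : P * H * P = (a : ℂ) • P) (ha : |a| ≤ ‖H‖) :
    a ^ 2 - 6 * ‖H‖ ^ 2 * e ≤ (φ H).re ^ 2 := by
  set x := (φ H).re
  have he₁ : e ≤ 1 := by
    have hnonneg : 0 ≤ (φ P).re := (Complex.le_def.1 (φ.map_nonneg hP.nonneg)).1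
    nlinarith
  have h := hφ.abs_re_map_sub_compression_le hP he hPe H
  rw [hPHP, map_smul, smul_eq_mul, Complex.re_ofReal_mul, hPe] at h
  have hae : |a * e ^ 2| ≤ ‖H‖ * e := by
    rw [abs_mul, abs_of_nonneg (sq_nonneg e), sq]
    gcongr
    exact mul_le_of_le_one_left he he₁
  have hx : |x - a| ≤ 3 * ‖H‖ * e := calc
    |x - a| = |(x - a * (1 - e ^ 2)) + -(a * e ^ 2)| := by congr 1; ring
    _ ≤ 2 * ‖H‖ * e + ‖H‖ * e := (abs_add_le _ _).trans (add_le_add h ((abs_neg _).trans_le hae))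
    _ = 3 * ‖H‖ * e := by ring
  have hax : |a * (x - a)| ≤ ‖H‖ * (3 * ‖H‖ * e) := by
    rw [abs_mul]
    gcongr
  linarith [sq_nonneg (x - a), neg_abs_le (a * (x - a))]

theorem le_re_map_liouvillian_liouvillian (hφ : IsState φ) (hP : IsStarProjection P)
    (he : 0 ≤ e) (hPe : (φ P).re = 1 - e ^ 2) (hPHP : P * H * P = (a : ℂ) • P) (ha : |a| ≤ ‖H‖)
    (hH : IsSelfAdjoint H) {O : A} (hOP : O * P = 0) {g : ℝ} (hg : 0 ≤ g)
    (hgap : g • (1 - P) ≤ O) :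
    2 * (g * ((φ (H * H)).re - (φ H).re ^ 2) - e * ‖H‖ ^ 2 * (8 * g + ‖O‖)) ≤
      (φ (liouvillian H (liouvillian H O))).re := by
  have hO : IsSelfAdjoint O := .of_nonneg ((smul_nonneg hg hP.one_sub.nonneg).trans hgap)
  have hPO : P * O = 0 := by
    rw [← star_eq_zero, star_mul, hO.star_eq, hP.isSelfAdjoint.star_eq, hOP]
  have hHH : ‖H * H‖ = ‖H‖ ^ 2 := by
    nth_rewrite 1 [← hH.star_eq]
    rw [CStarRing.norm_star_mul_self, sq]
  have left := hφ.abs_re_map_mul_le_of_mul_projection_eq_zero hP he hPe hOP (H * H)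
  have right := hφ.abs_re_map_mul_le_of_projection_mul_eq_zero hP he hPe hPO (H * H)
  have middle := mul_sub_le_re_map_conj φ hH hgap
  have ground := mul_le_mul_of_nonneg_left (hφ.re_map_mul_projection_mul_le hP he hPe hPHP) hg
  have mean := mul_le_mul_of_nonneg_left (hφ.sq_sub_le_sq_re_map hP he hPe hPHP ha) hg
  rw [hHH] at left right
  rw [liouvillian_liouvillian, map_sub, map_sub, two_nsmul, map_add]
  simp only [Complex.sub_re, Complex.add_re]
  linarith [le_abs_self (φ (H * H * O)).re, le_abs_self (φ (O * (H * H))).re]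

end IsState

end State

section Matrices

open scoped MatrixOrder

variable {d : Type*} [Fintype d] [DecidableEq d]

theorem two_mul_norm_sub_midpoint_eigenvalues_le {H : Matrix d d ℂ} (hH : H.IsHermitian) :
    2 * ‖H - ((((⨆ i, hH.eigenvalues i) + ⨅ i, hH.eigenvalues i) / 2 : ℝ) : ℂ) • 1‖ ≤
      (⨆ i, hH.eigenvalues i) - ⨅ i, hH.eigenvalues i := by
  set M := ⨆ i, hH.eigenvalues i
  set m := ⨅ i, hH.eigenvalues i
  have hsa : IsSelfAdjoint H := hH
  have mem_Icc : ∀ i, hH.eigenvalues i ∈ Set.Icc m M := fun i =>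
    ⟨ciInf_le (Set.finite_range _).bddBelow i, le_ciSup (Set.finite_range _).bddAbove i⟩
  have hmM : m ≤ M := by
    cases isEmpty_or_nonempty d
    · simp [m, M]
    · exact (mem_Icc (Classical.arbitrary d)).1.trans (mem_Icc _).2
  have cfc_eq : H - (((M + m) / 2 : ℝ) : ℂ) • 1 = cfc (fun x : ℝ => x - (M + m) / 2) H := by
    rw [cfc_sub (fun x : ℝ => x) fun _ => (M + m) / 2, cfc_id' ℝ H, cfc_const _ H,
      Algebra.algebraMap_eq_smul_one, Complex.coe_smul]
  have bound : ‖H - (((M + m) / 2 : ℝ) : ℂ) • 1‖ ≤ (M - m) / 2 := by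
    rw [cfc_eq]
    refine norm_cfc_le (by linarith) fun x hx => ?_
    rw [hH.spectrum_real_eq_range_eigenvalues] at hx
    obtain ⟨i, rfl⟩ := hx
    rw [Real.norm_eq_abs, abs_le]
    constructor <;> linarith [(mem_Icc i).1, (mem_Icc i).2]
  linarith

theorem posSemidef_of_orthonormalBasis {ι : Type*} [Fintype ι] {M : Matrix d d ℂ}
    (b : OrthonormalBasis ι ℂ (EuclideanSpace ℂ d)) {μ : ι → ℝ} (hμ : ∀ i, 0 ≤ μ i)
    (hM : ∀ i, Matrix.toEuclideanLin M (b i) = (μ i : ℂ) • b i) : M.PosSemidef := by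
  classical
  have spectral : M = ∑ i, (μ i : ℂ) • Matrix.vecMulVec (b i).ofLp (star (b i).ofLp) := by
    apply Matrix.toEuclideanLin.injective
    simp only [← InnerProductSpace.symm_toEuclideanLin_rankOne, ← map_smul, ← map_sum,
      LinearEquiv.apply_symm_apply]
    refine b.toBasis.ext fun j => ?_
    simp [hM, b.inner_eq_ite]
  rw [spectral]
  exact Matrix.posSemidef_sum _ fun i _ =>
    (Matrix.posSemidef_vecMulVec_self_star _).smul (Complex.zero_le_real.2 (hμ i))

/-- The expectation `X ↦ Tr[ρ X]` in the density operator `ρ`. -/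
noncomputable def traceFunctional {ρ : Matrix d d ℂ} (hρ : ρ.PosSemidef) :
    Matrix d d ℂ →ₚ[ℂ] ℂ :=
  .mk₀ (Matrix.traceLinearMap d ℂ ℂ ∘ₗ LinearMap.mulLeft ℂ ρ) fun X hX => by
    obtain ⟨B, rfl⟩ := CStarAlgebra.nonneg_iff_eq_star_mul_self.mp hρ.nonneg
    have h := ((Matrix.nonneg_iff_posSemidef.1 hX).mul_mul_conjTranspose_same B).trace_nonneg
    rw [Matrix.trace_mul_cycle] at h
    exact h

theorem traceFunctional_apply {ρ : Matrix d d ℂ} (hρ : ρ.PosSemidef) (X : Matrix d d ℂ) :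
    traceFunctional hρ X = (ρ * X).trace := rfl

end Matrices

namespace EigenDecomp

open scoped MatrixOrder

variable {n : ℕ} {O : QOp n} (E : EigenDecomp O)

theorem mulVec_v (i : Fin (2 ^ n)) : O *ᵥ (E.v i).ofLp = (E.lam i : ℂ) • (E.v i).ofLp :=
  congrArg WithLp.ofLp (E.eigen i)

theorem star_dotProduct_v (i j : Fin (2 ^ n)) :
    star (E.v i).ofLp ⬝ᵥ (E.v j).ofLp = if i = j then 1 else 0 := by
  rw [← E.v.inner_eq_ite, EuclideanSpace.inner_eq_star_dotProduct, dotProduct_comm]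

theorem abs_lam_le (i : Fin (2 ^ n)) : |E.lam i| ≤ ‖O‖ := by
  have h : ‖(E.lam i : ℂ) • E.v i‖ ≤ ‖O‖ * ‖E.v i‖ :=
    E.eigen i ▸ Matrix.l2_opNorm_mulVec O (E.v i)
  rwa [norm_smul, E.v.norm_eq_one, mul_one, mul_one, Complex.norm_real] at h

theorem gap_nonneg : 0 ≤ E.gap := sub_nonneg.2 (E.lam_mono (Fin.zero_le _))

theorem isStarProjection_groundProj : IsStarProjection E.groundProj where
  isIdempotentElem := by
    rw [IsIdempotentElem, groundProj, Matrix.vecMulVec_mul_vecMulVec, E.star_dotProduct_v,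
      if_pos rfl, one_smul]
  isSelfAdjoint := by
    rw [isSelfAdjoint_iff, Matrix.star_eq_conjTranspose, groundProj,
      Matrix.conjTranspose_vecMulVec, star_star]

theorem exists_groundProj_mul_mul {H : QOp n} (hH : IsSelfAdjoint H) :
    ∃ a : ℝ, E.groundProj * H * E.groundProj = (a : ℂ) • E.groundProj ∧ |a| ≤ ‖H‖ := by
  set z : ℂ := star (E.v 0).ofLp ⬝ᵥ H *ᵥ (E.v 0).ofLp
  have compress : E.groundProj * H * E.groundProj = z • E.groundProj := by
    rw [mul_assoc, groundProj, Matrix.mul_vecMulVec, Matrix.vecMulVec_mul_vecMulVec,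
      Matrix.vecMulVec_smul]
  have hzre : (z.re : ℂ) = z :=
    Complex.ext rfl (Matrix.IsHermitian.im_star_dotProduct_mulVec_self hH (E.v 0).ofLp).symm
  have hzinner : z = inner ℂ (E.v 0) (WithLp.toLp 2 (H *ᵥ (E.v 0).ofLp)) := by
    rw [EuclideanSpace.inner_eq_star_dotProduct, dotProduct_comm]
  refine ⟨z.re, by rw [compress, hzre], (Complex.abs_re_le_norm z).trans ?_⟩
  calc ‖z‖ ≤ ‖E.v 0‖ * ‖WithLp.toLp 2 (H *ᵥ (E.v 0).ofLp)‖ := hzinner ▸ norm_inner_le_norm _ _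
    _ ≤ ‖E.v 0‖ * (‖H‖ * ‖E.v 0‖) := by gcongr; exact Matrix.l2_opNorm_mulVec H (E.v 0)
    _ = ‖H‖ := by rw [E.v.norm_eq_one, one_mul, mul_one]

/-- The observable, shifted so that its ground energy vanishes. -/
noncomputable def excitation : QOp n := O - (E.lam 0 : ℂ) • 1

theorem norm_excitation_le : ‖E.excitation‖ ≤ 2 * ‖O‖ := by
  have h : ‖(E.lam 0 : ℂ) • (1 : QOp n)‖ ≤ ‖O‖ := by
    rw [norm_smul, norm_one, mul_one, Complex.norm_real]
    exact E.abs_lam_le 0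
  rw [excitation]
  linarith [norm_sub_le O ((E.lam 0 : ℂ) • 1)]

theorem excitation_mul_groundProj : E.excitation * E.groundProj = 0 := by
  rw [excitation, groundProj, Matrix.mul_vecMulVec, Matrix.sub_mulVec, Matrix.smul_mulVec,
    Matrix.one_mulVec, E.mulVec_v, sub_self, Matrix.zero_vecMulVec]

theorem gap_smul_one_sub_groundProj_le : E.gap • (1 - E.groundProj) ≤ E.excitation := by
  refine posSemidef_of_orthonormalBasis E.v
    (μ := fun i => if i = 0 then 0 else E.lam i - E.lam 1) (fun i => ?_) fun i => ?_
  · split_ifs with hi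
    · exact le_rfl
    · exact sub_nonneg.2 (E.lam_mono (Fin.one_le_of_ne_zero hi))
  · apply WithLp.ofLp_injective
    change (E.excitation - E.gap • (1 - E.groundProj)) *ᵥ (E.v i).ofLp = _ • (E.v i).ofLp
    rw [excitation, Matrix.sub_mulVec, Matrix.sub_mulVec, Matrix.smul_mulVec, Matrix.smul_mulVec,
      Matrix.sub_mulVec, Matrix.one_mulVec, E.mulVec_v, groundProj, Matrix.vecMulVec_mulVec,
      E.star_dotProduct_v, gap]
    rcases eq_or_ne i 0 with rfl | hi
    · simp
    · rw [if_neg hi, if_neg hi.symm, ← Complex.coe_smul, MulOpposite.op_zero, zero_smul, sub_zero]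
      push_cast
      module

end EigenDecomp

theorem continuous_prod_ofFn {X M : Type*} [TopologicalSpace X] [TopologicalSpace M] [Monoid M]
    [ContinuousMul M] {g : ℕ} {f : Fin g → X → M} (hf : ∀ l, Continuous (f l)) :
    Continuous fun x => (List.ofFn fun l => f l x).prod := by
  simp only [List.ofFn_eq_map]
  exact continuous_list_prod _ fun l _ => hf l

namespace VarProblem

open scoped MatrixOrder

variable {n m K : ℕ} (P : VarProblem n m K)

/-- The input density operator `ρ`, as the functional `X ↦ Tr[ρ X]`. -/
noncomputable def inputState : QOp n →ₚ[ℂ] ℂ := traceFunctional P.ρ_psd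

theorem isState_inputState : IsState P.inputState where
  map_one := by rw [inputState, traceFunctional_apply, mul_one, P.ρ_trace]

/-- The expectation value of an observable in the input state. -/
noncomputable def expect : QOp n →L[ℝ] ℝ :=
  Complex.reCLM ∘L (P.inputState.toLinearMap.restrictScalars ℝ).toContinuousLinearMap

theorem expect_apply (X : QOp n) : P.expect X = (P.inputState X).re := rfl

theorem norm_expect_le (X : QOp n) : ‖P.expect X‖ ≤ ‖X‖ :=
  (Complex.abs_re_le_norm _).trans (P.isState_inputState.norm_map_le X)

theorem gate_mem_unitary (l : Fin (K + 1)) (t : ℝ) : P.gate l t ∈ unitary (QOp n) :=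
  mul_mem (P.V l).2 (evolution_mem_unitary (P.H_herm l) t)

theorem circuit_mem_unitary (θ : Fin m → ℝ) : P.circuit θ ∈ unitary (QOp n) := by
  refine Submonoid.list_prod_mem _ fun x hx => ?_
  obtain ⟨l, rfl⟩ := (List.mem_ofFn' _ _).1 hx
  exact P.gate_mem_unitary _ _

theorem continuous_gate (l : Fin (K + 1)) : Continuous (P.gate l) :=
  continuous_const.mul (contDiff_evolution (P.H l)).continuous

theorem continuous_circuit : Continuous P.circuit :=
  continuous_prod_ofFn fun l => (P.continuous_gate l).comp (continuous_apply (P.S l))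

/-- The Heisenberg picture `X ↦ U(θ)† X U(θ)` of the circuit. -/
noncomputable def pullback (θ : Fin m → ℝ) : QOp n ≃⋆ₐ[ℂ] QOp n :=
  (Unitary.conjStarAlgAut ℂ (QOp n) ⟨P.circuit θ, P.circuit_mem_unitary θ⟩).symm

theorem pullback_apply (θ : Fin m → ℝ) (X : QOp n) :
    P.pullback θ X = star (P.circuit θ) * X * P.circuit θ :=
  Unitary.conjStarAlgAut_symm_apply ..

theorem continuous_pullback (X : QOp n) : Continuous fun θ => P.pullback θ X := by
  simp only [pullback_apply]
  exact (P.continuous_circuit.star.mul continuous_const).mul P.continuous_circuit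

theorem trace_evolved_mul (θ : Fin m → ℝ) (X : QOp n) :
    (P.evolved θ * X).trace = P.inputState (P.pullback θ X) := by
  rw [inputState, traceFunctional_apply, pullback_apply, evolved, mul_assoc, mul_assoc,
    Matrix.trace_mul_comm, ← Matrix.star_eq_conjTranspose]
  simp only [mul_assoc]

theorem loss_eq (θ : Fin m → ℝ) : P.loss θ = P.expect (P.pullback θ P.O) :=
  congrArg Complex.re (P.trace_evolved_mul θ P.O)

theorem continuous_loss : Continuous P.loss := by
  simp only [funext P.loss_eq]
  exact P.expect.continuous.comp (P.continuous_pullback P.O)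

theorem isSelfAdjoint_lastH : IsSelfAdjoint P.lastH := P.H_herm (Fin.last K)

/-- The second derivative of the loss in the direction of the last parameter, when that parameter
drives no other generator (see `iteratedDeriv_two_loss`). -/
noncomputable def lossCurv (θ : Fin m → ℝ) : ℝ :=
  P.expect (liouvillian P.lastH (liouvillian P.lastH (P.pullback θ P.O)))

theorem continuous_lossCurv : Continuous P.lossCurv :=
  (P.expect ∘L liouvillian P.lastH ∘L liouvillian P.lastH).continuous.comp
    (P.continuous_pullback P.O)

theorem stateVar_eq : P.stateVar =
    (P.inputState (P.lastH * P.lastH)).re - (P.inputState P.lastH).re ^ 2 := rfl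

theorem two_mul_norm_sub_midpoint_le_gateFreq (l : Fin (K + 1)) :
    ∃ c : ℝ, 2 * ‖P.H l - (c : ℂ) • 1‖ ≤ P.gateFreq l :=
  ⟨_, two_mul_norm_sub_midpoint_eigenvalues_le (P.H_herm l)⟩

theorem gateFreq_nonneg (l : Fin (K + 1)) : 0 ≤ P.gateFreq l := by
  obtain ⟨c, hc⟩ := P.two_mul_norm_sub_midpoint_le_gateFreq l
  exact le_trans (by positivity) hc

theorem maxFreq_nonneg (q : Fin m) : 0 ≤ P.maxFreq q :=
  Finset.sum_nonneg fun l _ => P.gateFreq_nonneg l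

theorem norm_liouvillian_le (l : Fin (K + 1)) (X : QOp n) :
    ‖liouvillian (P.H l) X‖ ≤ P.gateFreq l * ‖X‖ := by
  obtain ⟨c, hc⟩ := P.two_mul_norm_sub_midpoint_le_gateFreq l
  exact (norm_liouvillian_apply_le (P.H l) c X).trans (by gcongr)

theorem bandLimited_pullback (θ : Fin m → ℝ) (j : Fin m) (X : QOp n) :
    BandLimited ‖X‖ (P.maxFreq j) fun t => P.pullback (θ + Pi.single j t) X := by
  have conj_gate : ∀ (l : Fin (K + 1)) (c w : ℝ) (Y : ℝ → QOp n), BandLimited c w Y →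
      BandLimited c (w + if P.S l = j then P.gateFreq l else 0) fun t =>
        star (P.gate l ((θ + Pi.single j t : Fin m → ℝ) (P.S l))) * Y t *
          P.gate l ((θ + Pi.single j t : Fin m → ℝ) (P.S l)) := fun l c w Y hY => by
    by_cases hl : P.S l = j
    · have gate_add : ∀ t, P.gate l ((θ + Pi.single j t : Fin m → ℝ) (P.S l)) =
          P.gate l (θ j) * evolution (P.H l) t := fun t => by
        rw [hl, Pi.add_apply, Pi.single_eq_same, gate, gate, ← evolution, ← evolution,
          evolution_add, mul_assoc]
      simpa only [gate_add, if_pos hl, star_mul, mul_assoc] using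
        (hY.conj_unitary (P.gate_mem_unitary l (θ j))).conj_evolution (P.H_herm l)
          (P.norm_liouvillian_le l) (P.gateFreq_nonneg l)
    · simpa only [Pi.add_apply, Pi.single_eq_of_ne hl, add_zero, if_neg hl] using
        hY.conj_unitary (P.gate_mem_unitary l (θ (P.S l)))
  simpa only [pullback_apply, circuit, maxFreq, Finset.sum_filter, zero_add] using
    BandLimited.conj_list_prod conj_gate (.const X)

theorem bandLimited_loss (θ : Fin m → ℝ) (j : Fin m) :
    BandLimited ‖P.O‖ (P.maxFreq j) fun t => P.loss (θ + Pi.single j t) := by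
  simpa only [loss_eq] using
    (P.bandLimited_pullback θ j P.O).clm_comp_of_contraction P.expect P.norm_expect_le

theorem bandLimited_lossCurv (θ : Fin m → ℝ) (j : Fin m) :
    BandLimited (P.gateFreq (Fin.last K) ^ 2 * ‖P.O‖) (P.maxFreq j)
      fun t => P.lossCurv (θ + Pi.single j t) := by
  have comp_liouvillian {c w : ℝ} {Y : ℝ → QOp n} (hY : BandLimited c w Y) :=
    hY.clm_comp (liouvillian P.lastH) (P.norm_liouvillian_le (Fin.last K)) (P.gateFreq_nonneg _)
  rw [sq, mul_assoc]
  exact (comp_liouvillian (comp_liouvillian (P.bandLimited_pullback θ j P.O))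
    ).clm_comp_of_contraction P.expect P.norm_expect_le

section Uncorrelated

variable {P} (huncorr : ∀ l, P.S l = P.lastParam → l = Fin.last K)
include huncorr

theorem maxFreq_lastParam : P.maxFreq P.lastParam = P.gateFreq (Fin.last K) := by
  have filter_eq : Finset.univ.filter (fun l => P.S l = P.lastParam) = {Fin.last K} := by
    ext l
    simp only [Finset.mem_filter_univ, Finset.mem_singleton]
    exact ⟨huncorr l, fun h => h ▸ rfl⟩
  rw [maxFreq, filter_eq, Finset.sum_singleton]

theorem circuit_add_single_lastParam (θ : Fin m → ℝ) (t : ℝ) :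
    P.circuit (θ + Pi.single P.lastParam t) = P.circuit θ * evolution P.lastH t := by
  have hne : ∀ i : Fin K, P.S i.castSucc ≠ P.lastParam := fun i hi =>
    (Fin.castSucc_lt_last i).ne (huncorr _ hi)
  have hlast : P.gate (Fin.last K) ((θ + Pi.single P.lastParam t : Fin m → ℝ) P.lastParam) =
      P.gate (Fin.last K) (θ P.lastParam) * evolution P.lastH t := by
    rw [Pi.add_apply, Pi.single_eq_same, gate, gate, ← evolution, ← evolution, evolution_add,
      ← mul_assoc, lastH]
  rw [circuit, circuit, List.ofFn_succ', List.ofFn_succ', List.prod_concat, List.prod_concat,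
    mul_assoc, ← lastParam, hlast]
  simp only [Pi.add_apply, Pi.single_eq_of_ne (hne _), add_zero]

theorem iteratedDeriv_two_loss (θ : Fin m → ℝ) :
    iteratedDeriv 2 (fun t => P.loss (θ + Pi.single P.lastParam t)) 0 = P.lossCurv θ := by
  have line_eq : ∀ t, P.loss (θ + Pi.single P.lastParam t) =
      P.expect (star (evolution P.lastH t) * P.pullback θ P.O * evolution P.lastH t) := fun t => by
    rw [loss_eq, pullback_apply, pullback_apply, circuit_add_single_lastParam huncorr, star_mul]
    simp only [mul_assoc]
  simp only [line_eq]
  exact iteratedDeriv_two_conj_evolution P.isSelfAdjoint_lastH _ _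

end Uncorrelated

theorem le_lossCurv (E : EigenDecomp P.O) (θ : Fin m → ℝ) {e : ℝ} (he : 0 ≤ e)
    (hfid : (P.evolved θ * E.groundProj).trace = ((1 - e ^ 2 : ℝ) : ℂ)) :
    2 * (E.gap * P.stateVar - e * ‖P.lastH‖ ^ 2 * (8 * E.gap + 2 * ‖P.O‖)) ≤ P.lossCurv θ := by
  set T := P.pullback θ
  have norm_T : ∀ X, ‖T X‖ = ‖X‖ := fun X => by
    rw [P.pullback_apply, norm_star_mul_mul_of_mem_unitary (P.circuit_mem_unitary θ)]
  obtain ⟨a, compress, ha⟩ := E.exists_groundProj_mul_mul (P.isSelfAdjoint_lastH.map T.symm)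
  have norm_symm : ‖T.symm P.lastH‖ = ‖P.lastH‖ := by rw [← norm_T, T.apply_symm_apply]
  have compress_T : T E.groundProj * P.lastH * T E.groundProj = (a : ℂ) • T E.groundProj := by
    rw [← map_smul, ← compress, map_mul, map_mul, T.apply_symm_apply]
  have gap_T : E.gap • (1 - T E.groundProj) ≤ T E.excitation := by
    have h := OrderHomClass.mono T E.gap_smul_one_sub_groundProj_le
    rwa [← Complex.coe_smul, map_smul, map_sub, map_one, Complex.coe_smul] at h
  have curv_T : liouvillian P.lastH (liouvillian P.lastH (T P.O)) =
      liouvillian P.lastH (liouvillian P.lastH (T E.excitation)) := by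
    rw [EigenDecomp.excitation, map_sub, map_smul, map_one, map_sub, liouvillian_smul_one, sub_zero]
  have h := P.isState_inputState.le_re_map_liouvillian_liouvillian
    (E.isStarProjection_groundProj.map T) he
    (by rw [← P.trace_evolved_mul, hfid, Complex.ofReal_re]) compress_T (norm_symm ▸ ha)
    P.isSelfAdjoint_lastH (by rw [← map_mul, E.excitation_mul_groundProj, map_zero])
    E.gap_nonneg gap_T
  rw [lossCurv, expect_apply, curv_T, stateVar_eq]
  refine le_trans ?_ h
  have := E.norm_excitation_le
  rw [norm_T]
  gcongr

end VarProblem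

section Covariance

variable {Ω : Type*} [MeasurableSpace Ω] {μ : Measure Ω} [IsProbabilityMeasure μ] {X Y : Ω → ℝ}

theorem covariance_eq_integral_sub_mul (hX : Integrable X μ) (hY : Integrable Y μ)
    (hXY : Integrable (fun x => X x * Y x) μ) :
    cov[X, Y; μ] = ∫ x, (X x - ∫ y, X y ∂μ) * Y x ∂μ := by
  have hcentred : Integrable (fun x => X x - ∫ y, X y ∂μ) μ := hX.sub (integrable_const _)
  have hmul : Integrable (fun x => (X x - ∫ y, X y ∂μ) * Y x) μ := by
    simp only [sub_mul]
    exact hXY.sub (hY.const_mul _)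
  have mean_centred : ∫ x, (X x - ∫ y, X y ∂μ) ∂μ = 0 := by
    rw [integral_sub hX (integrable_const _), integral_const, probReal_univ, one_smul, sub_self]
  simp only [covariance, mul_sub (X _ - _)]
  rw [integral_sub hmul (hcentred.mul_const _), integral_mul_const, mean_centred, zero_mul,
    sub_zero]

theorem sq_covariance_le (hX : MemLp X 2 μ) (hY : MemLp Y 2 μ) :
    cov[X, Y; μ] ^ 2 ≤ Var[X; μ] * Var[Y; μ] := by
  have h : ∀ c : ℝ, 0 ≤ Var[X; μ] * (c * c) + 2 * cov[X, Y; μ] * c + Var[Y; μ] := fun c => by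
    have hnonneg := variance_nonneg (fun x => c * X x + Y x) μ
    rw [variance_fun_add (hX.const_mul c) hY, variance_const_mul, covariance_const_mul_left]
      at hnonneg
    linarith
  have hdiscrim := discrim_le_zero h
  rw [discrim] at hdiscrim
  linarith

end Covariance

theorem integrable_of_continuous_of_ae_mem_isCompact {X : Type*} [TopologicalSpace X] [T2Space X]
    [MeasurableSpace X] [OpensMeasurableSpace X] {μ : Measure X} [IsFiniteMeasure μ] {s : Set X}
    (hs : IsCompact s) (hμ : ∀ᵐ x ∂μ, x ∈ s) {f : X → ℝ} (hf : Continuous f) : Integrable f μ := by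
  rw [← Measure.restrict_eq_self_of_ae_mem hμ]
  exact hf.continuousOn.integrableOn_compact hs

section Symmetric

variable {ν : Measure ℝ} [ν.IsNegInvariant] {r : ℝ} {f : ℝ → ℝ}

theorem integral_eq_integral_add_neg_div_two (hf : Integrable f ν) :
    ∫ t, f t ∂ν = ∫ t, (f t + f (-t)) / 2 ∂ν := by
  rw [integral_div, integral_add hf hf.comp_neg, integral_neg_eq_self]
  ring

variable [IsProbabilityMeasure ν] (hν : ∀ᵐ t ∂ν, t ∈ Set.Icc (-r) r) (hf : Continuous f)
include hν hf

theorem sub_le_integral_of_second_difference_le {M : ℝ} (hM : 0 ≤ M)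
    (h : ∀ t, |f t + f (-t) - 2 * f 0| ≤ M * t ^ 2) : f 0 - r ^ 2 / 2 * M ≤ ∫ t, f t ∂ν := by
  have integrable {g : ℝ → ℝ} (hg : Continuous g) : Integrable g ν :=
    integrable_of_continuous_of_ae_mem_isCompact isCompact_Icc hν hg
  calc f 0 - r ^ 2 / 2 * M = ∫ _, f 0 - r ^ 2 / 2 * M ∂ν := by simp
    _ ≤ ∫ t, (f t + f (-t)) / 2 ∂ν := by
      refine integral_mono_ae (integrable_const _) (integrable (by fun_prop)) ?_
      filter_upwards [hν] with t ht
      have := mul_le_mul_of_nonneg_left (sq_le_sq' ht.1 ht.2) hM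
      linarith [(abs_le.1 (h t)).1]
    _ = ∫ t, f t ∂ν := (integral_eq_integral_add_neg_div_two (integrable hf)).symm

theorem sub_le_covariance_sq_of_second_difference_le {a C : ℝ} (hC : 0 ≤ C)
    (h : ∀ t, |f t + f (-t) - 2 * f 0 - t ^ 2 * a| ≤ C * t ^ 4) :
    Var[fun t => t ^ 2; ν] / 2 * a - C * r ^ 6 / 2 ≤ cov[fun t => t ^ 2, f; ν] := by
  have integrable {g : ℝ → ℝ} (hg : Continuous g) : Integrable g ν :=
    integrable_of_continuous_of_ae_mem_isCompact isCompact_Icc hν hg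
  have cov_eq {g : ℝ → ℝ} (hg : Continuous g) := covariance_eq_integral_sub_mul (μ := ν)
    (integrable (continuous_pow 2)) (integrable hg) (integrable (by fun_prop))
  set s := ∫ t, t ^ 2 ∂ν with hs
  have hsq : ∀ᵐ t ∂ν, t ^ 2 ≤ r ^ 2 := hν.mono fun t ht => sq_le_sq' ht.1 ht.2
  have hs₀ : 0 ≤ s := integral_nonneg fun t => sq_nonneg t
  have hsr : s ≤ r ^ 2 := by
    simpa using integral_mono_ae (integrable (continuous_pow 2)) (integrable_const (r ^ 2)) hsq
  have centred : ∫ t, (t ^ 2 - s) ∂ν = 0 := by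
    rw [integral_sub (integrable (by fun_prop)) (integrable_const _), ← hs]
    simp
  have var_eq : Var[fun t => t ^ 2; ν] = ∫ t, (t ^ 2 - s) * t ^ 2 ∂ν := by
    rw [← covariance_self (by fun_prop), cov_eq (by fun_prop)]
  rw [cov_eq hf, integral_eq_integral_add_neg_div_two (integrable (by fun_prop))]
  calc Var[fun t => t ^ 2; ν] / 2 * a - C * r ^ 6 / 2
      = ∫ t, ((t ^ 2 - s) * f 0 + (t ^ 2 - s) * t ^ 2 * (a / 2) - C * r ^ 6 / 2) ∂ν := by
        rw [integral_sub (integrable (by fun_prop)) (integrable_const _),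
          integral_add (integrable (by fun_prop)) (integrable (by fun_prop)), integral_mul_const,
          integral_mul_const, centred, ← var_eq, integral_const, probReal_univ, one_smul]
        ring
    _ ≤ ∫ t, ((t ^ 2 - s) * f t + ((-t) ^ 2 - s) * f (-t)) / 2 ∂ν := by
        refine integral_mono_ae (integrable (by fun_prop)) (integrable (by fun_prop)) ?_
        filter_upwards [hsq] with t ht
        have weight_le : |t ^ 2 - s| ≤ r ^ 2 := abs_le.2 ⟨by linarith [sq_nonneg t], by linarith⟩
        have fourth_le : t ^ 4 ≤ r ^ 4 := by
          simpa only [← pow_mul] using pow_le_pow_left₀ (sq_nonneg t) ht 2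
        have remainder := mul_le_mul weight_le
          ((h t).trans (mul_le_mul_of_nonneg_left fourth_le hC)) (abs_nonneg _) (sq_nonneg r)
        rw [← abs_mul] at remainder
        linarith [(abs_le.1 remainder).1]

end Symmetric

section Product

variable {ι : Type*} [Fintype ι] [DecidableEq ι]

theorem measurePreserving_update {X : ι → Type*} [∀ i, MeasurableSpace (X i)]
    (μ : ∀ i, Measure (X i)) [∀ i, SigmaFinite (μ i)] (p : ι) [IsProbabilityMeasure (μ p)] :
    MeasurePreserving (fun z : (∀ i, X i) × X p => Function.update z.1 p z.2)
      ((Measure.pi μ).prod (μ p)) (Measure.pi μ) where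
  measurable := by fun_prop
  map_eq := by
    refine (Measure.pi_eq fun s hs => ?_).symm
    have preimage_eq : (fun z : (∀ i, X i) × X p => Function.update z.1 p z.2) ⁻¹'
        Set.univ.pi s = Set.univ.pi (Function.update s p Set.univ) ×ˢ s p := by
      ext z
      simp only [Set.mem_preimage, Set.mem_prod, Set.mem_univ_pi]
      refine ⟨fun h => ⟨fun i => ?_, by simpa using h p⟩, fun h i => ?_⟩ <;>
        rcases eq_or_ne i p with rfl | hi
      · simp
      · simpa [hi] using h i
      · simpa using h.2
      · simpa [hi] using h.1 i
    rw [Measure.map_apply (by fun_prop) (.univ_pi hs), preimage_eq, Measure.prod_prod,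
      Measure.pi_pi, ← Finset.mul_prod_erase _ _ (Finset.mem_univ p),
      ← Finset.mul_prod_erase Finset.univ (fun i => μ i (s i)) (Finset.mem_univ p),
      Function.update_self, measure_univ, one_mul, mul_comm]
    congr 1
    refine Finset.prod_congr rfl fun i hi => ?_
    rw [Function.update_of_ne (Finset.ne_of_mem_erase hi)]

theorem integral_le_integral_of_le_integral_update {X : ι → Type*} [∀ i, MeasurableSpace (X i)]
    {μ : ∀ i, Measure (X i)} [∀ i, SigmaFinite (μ i)] (p : ι) [IsProbabilityMeasure (μ p)]
    {f g : (∀ i, X i) → ℝ}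
    (hf : Integrable f (Measure.pi μ)) (hg : Integrable g (Measure.pi μ))
    (h : ∀ x, f x ≤ ∫ y, g (Function.update x p y) ∂μ p) :
    ∫ x, f x ∂Measure.pi μ ≤ ∫ x, g x ∂Measure.pi μ := by
  have hmp := measurePreserving_update μ p
  have hcomp := hmp.integrable_comp_of_integrable hg
  calc ∫ x, f x ∂Measure.pi μ ≤ ∫ x, ∫ y, g (Function.update x p y) ∂μ p ∂Measure.pi μ :=
        integral_mono hf hcomp.integral_prod_left h
    _ = ∫ z, g (Function.update z.1 p z.2) ∂(Measure.pi μ).prod (μ p) :=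
        (integral_prod _ hcomp).symm
    _ = ∫ x, g x ∂Measure.pi μ := by
        rw [← hmp.map_eq] at hg
        conv_rhs => rw [← hmp.map_eq]
        exact (integral_map hmp.measurable.aemeasurable hg.aestronglyMeasurable).symm

omit [Fintype ι] in
theorem update_zero_add_single (x : ι → ℝ) (p : ι) (t : ℝ) :
    Function.update x p 0 + Pi.single p t = Function.update x p t := by
  ext i
  rcases eq_or_ne i p with rfl | hi
  · simp
  · simp [hi]

variable {ν : Measure ℝ} [IsProbabilityMeasure ν] {r : ℝ} (hν : ∀ᵐ t ∂ν, t ∈ Set.Icc (-r) r)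
include hν

omit [DecidableEq ι] in
theorem integrable_pi_of_continuous {f : (ι → ℝ) → ℝ} (hf : Continuous f) :
    Integrable f (Measure.pi fun _ => ν) := by
  refine integrable_of_continuous_of_ae_mem_isCompact
    (isCompact_univ_pi fun _ : ι => isCompact_Icc (a := -r) (b := r)) ?_ hf
  simp only [Set.mem_univ_pi]
  exact ae_all_iff.2 fun i => (measurePreserving_eval _ i).quasiMeasurePreserving.ae hν

variable [ν.IsNegInvariant]

theorem sub_le_integral_pi_piecewise_of_second_difference_le {F : (ι → ℝ) → ℝ} (hF : Continuous F)
    {M : ι → ℝ} (hM : ∀ j, 0 ≤ M j)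
    (h : ∀ x j t, |F (x + Pi.single j t) + F (x + Pi.single j (-t)) - 2 * F x| ≤ M j * t ^ 2)
    (s : Finset ι) :
    F 0 - r ^ 2 / 2 * ∑ j ∈ s, M j ≤ ∫ x, F (s.piecewise x 0) ∂Measure.pi fun _ => ν := by
  have continuous_piecewise : ∀ s : Finset ι, Continuous fun x : ι → ℝ => F (s.piecewise x 0) :=
    fun s => hF.comp <| continuous_pi fun i => by
      by_cases hi : i ∈ s <;> simp only [Finset.piecewise, hi, if_true, if_false] <;> fun_prop
  induction s using Finset.induction_on with
  | empty => simp
  | insert j s hj ih =>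
    have step := integral_le_integral_of_le_integral_update j
      (f := fun x => F (s.piecewise x 0) - r ^ 2 / 2 * M j)
      (g := fun x => F ((insert j s).piecewise x 0))
      (integrable_pi_of_continuous hν ((continuous_piecewise s).sub continuous_const))
      (integrable_pi_of_continuous hν (continuous_piecewise (insert j s))) fun x => by
      have line_eq : ∀ y, (insert j s).piecewise (Function.update x j y) 0 =
          s.piecewise x 0 + Pi.single j y := fun y => by
        ext i
        rcases eq_or_ne i j with rfl | hi
        · simp [hj]
        · simp [Finset.piecewise, hi]
      simp only [line_eq]
      simpa only [Pi.single_zero, add_zero] using sub_le_integral_of_second_difference_le hν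
        (f := fun t => F (s.piecewise x 0 + Pi.single j t))
        (hF.comp (continuous_const.add (continuous_single (A := fun _ => ℝ) j))) (hM j)
        (by simpa only [Pi.single_zero, add_zero] using h (s.piecewise x 0) j)
    rw [integral_sub (integrable_pi_of_continuous hν (continuous_piecewise s))
      (integrable_const _), integral_const, probReal_univ, one_smul] at step
    rw [Finset.sum_insert hj]
    linarith

theorem sub_le_integral_pi_update_of_second_difference_le {F : (ι → ℝ) → ℝ} (hF : Continuous F)
    {M : ι → ℝ} (hM : ∀ j, 0 ≤ M j)
    (h : ∀ x j t, |F (x + Pi.single j t) + F (x + Pi.single j (-t)) - 2 * F x| ≤ M j * t ^ 2)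
    (p : ι) : F 0 - r ^ 2 / 2 * ∑ j ∈ Finset.univ.erase p, M j ≤
      ∫ x, F (Function.update x p 0) ∂Measure.pi fun _ => ν := by
  have erase_piecewise : ∀ x : ι → ℝ,
      (Finset.univ.erase p).piecewise x 0 = Function.update x p 0 := fun x => by
    rw [Finset.piecewise_erase_univ]
    rfl
  simpa only [erase_piecewise] using
    sub_le_integral_pi_piecewise_of_second_difference_le hν hF hM h (Finset.univ.erase p)

theorem sub_le_covariance_sq_eval_of_second_difference_le {L F : (ι → ℝ) → ℝ}
    (hL : Continuous L) (hF : Continuous F) {M : ι → ℝ} (hM : ∀ j, 0 ≤ M j) {C : ℝ} (hC : 0 ≤ C)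
    (p : ι)
    (hLF : ∀ x t, |L (x + Pi.single p t) + L (x + Pi.single p (-t)) - 2 * L x - t ^ 2 * F x| ≤
      C * t ^ 4)
    (hFM : ∀ x j t, |F (x + Pi.single j t) + F (x + Pi.single j (-t)) - 2 * F x| ≤ M j * t ^ 2) :
    Var[fun t => t ^ 2; ν] / 2 * (F 0 - r ^ 2 / 2 * ∑ j ∈ Finset.univ.erase p, M j) -
      C * r ^ 6 / 2 ≤ cov[fun x => x p ^ 2, L; Measure.pi fun _ => ν] := by
  set κ := Var[fun t => t ^ 2; ν]
  have mean_eq : ∫ x : ι → ℝ, x p ^ 2 ∂Measure.pi (fun _ => ν) = ∫ t, t ^ 2 ∂ν :=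
    integral_comp_eval (μ := fun _ : ι => ν) (f := fun t : ℝ => t ^ 2)
      (continuous_pow 2).aestronglyMeasurable
  have : Continuous fun x : ι → ℝ => F (Function.update x p 0) :=
    hF.comp (continuous_id.update p continuous_const)
  have fibre := integral_le_integral_of_le_integral_update p
    (f := fun x => κ / 2 * F (Function.update x p 0) - C * r ^ 6 / 2)
    (g := fun x => (x p ^ 2 - ∫ t, t ^ 2 ∂ν) * L x)
    (integrable_pi_of_continuous hν (by fun_prop)) (integrable_pi_of_continuous hν (by fun_prop))
    fun x => by
    have integrable {g : ℝ → ℝ} (hg : Continuous g) : Integrable g ν :=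
      integrable_of_continuous_of_ae_mem_isCompact isCompact_Icc hν hg
    have hLx : Continuous fun t => L (Function.update x p t) :=
      hL.comp (continuous_const.update p continuous_id)
    simp only [Function.update_self]
    rw [← covariance_eq_integral_sub_mul (integrable (by fun_prop)) (integrable hLx)
      (integrable (by fun_prop))]
    refine sub_le_covariance_sq_of_second_difference_le hν hLx hC ?_
    simpa only [update_zero_add_single] using hLF (Function.update x p 0)
  rw [integral_sub (integrable_pi_of_continuous hν (by fun_prop)) (integrable_const _),
    integral_const_mul, integral_const, probReal_univ, one_smul] at fibre
  rw [covariance_eq_integral_sub_mul (integrable_pi_of_continuous hν (by fun_prop))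
    (integrable_pi_of_continuous hν hL) (integrable_pi_of_continuous hν (by fun_prop)), mean_eq]
  have := mul_le_mul_of_nonneg_left
    (sub_le_integral_pi_update_of_second_difference_le hν hF hM hFM p)
    (div_nonneg (variance_nonneg (fun t => t ^ 2) ν) zero_le_two)
  linarith

end Product

theorem measurePreserving_cond_preimage {α β : Type*} [MeasurableSpace α] [MeasurableSpace β]
    {μ : Measure α} {ν : Measure β} {f : α → β} (hf : MeasurePreserving f μ ν) {s : Set β}
    (hs : MeasurableSet s) : MeasurePreserving f (cond μ (f ⁻¹' s)) (cond ν s) := by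
  rw [ProbabilityTheory.cond, ProbabilityTheory.cond, hf.measure_preimage hs.nullMeasurableSet]
  exact (hf.restrict_preimage hs).smul_measure _

theorem cond_pi {ι : Type*} [Fintype ι] {X : ι → Type*} [∀ i, MeasurableSpace (X i)]
    (μ : ∀ i, Measure (X i)) [∀ i, SigmaFinite (μ i)] {s : ∀ i, Set (X i)}
    (hs : ∀ i, MeasurableSet (s i)) (hzero : ∀ i, μ i (s i) ≠ 0) (htop : ∀ i, μ i (s i) ≠ ⊤) :
    cond (Measure.pi μ) (Set.univ.pi s) = Measure.pi fun i => cond (μ i) (s i) := by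
  have := fun i => cond_isProbabilityMeasure_of_finite (hzero i) (htop i)
  refine (Measure.pi_eq fun t _ => ?_).symm
  rw [cond_apply (.univ_pi hs), ← Set.pi_inter_distrib, Measure.pi_pi, Measure.pi_pi,
    ENNReal.prod_inv_distrib fun i _ j _ _ => Or.inl (hzero i), ← Finset.prod_mul_distrib]
  exact Finset.prod_congr rfl fun i _ => (cond_apply (hs i) _ _).symm

/-- The uniform distribution on the interval `[-r, r]`. -/
noncomputable def uniformIcc (r : ℝ) : Measure ℝ := cond volume (Set.Icc (-r) r)

section UniformIcc

theorem ae_mem_uniformIcc (r : ℝ) : ∀ᵐ t ∂uniformIcc r, t ∈ Set.Icc (-r) r :=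
  ae_cond_mem measurableSet_Icc

instance isNegInvariant_uniformIcc (r : ℝ) : (uniformIcc r).IsNegInvariant where
  neg_eq_self := by
    have h := measurePreserving_cond_preimage (Measure.measurePreserving_neg (volume : Measure ℝ))
      (measurableSet_Icc (a := -r) (b := r))
    rw [Set.neg_preimage, Set.neg_Icc, neg_neg] at h
    exact h.map_eq

variable {r : ℝ} (hr : 0 < r)
include hr

theorem isProbabilityMeasure_uniformIcc : IsProbabilityMeasure (uniformIcc r) :=
  cond_isProbabilityMeasure_of_finite (by simp [hr]) (by simp)

theorem integral_pow_uniformIcc (k : ℕ) :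
    ∫ t, t ^ (2 * k) ∂uniformIcc r = r ^ (2 * k) / (2 * k + 1) := by
  rw [uniformIcc, ProbabilityTheory.cond, Real.volume_Icc, integral_smul_measure,
    integral_Icc_eq_integral_Ioc, ← intervalIntegral.integral_of_le (by linarith), integral_pow,
    ENNReal.toReal_inv, ENNReal.toReal_ofReal (by linarith), Odd.neg_pow (by simp), smul_eq_mul]
  push_cast
  field_simp
  ring

theorem variance_sq_uniformIcc : Var[fun t => t ^ 2; uniformIcc r] = 4 / 45 * r ^ 4 := by
  have := isProbabilityMeasure_uniformIcc hr
  have bounded : MemLp (fun t : ℝ => t ^ 2) 2 (uniformIcc r) :=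
    MemLp.of_bound (by fun_prop) (r ^ 2) <| (ae_mem_uniformIcc r).mono fun t ht => by
      rw [Real.norm_of_nonneg (sq_nonneg t)]
      exact sq_le_sq' ht.1 ht.2
  have second := integral_pow_uniformIcc hr 1
  have fourth := integral_pow_uniformIcc hr 2
  norm_num at second fourth
  rw [variance_eq_sub bounded]
  simp only [Pi.pow_apply, ← pow_mul]
  norm_num
  rw [second, fourth]
  ring

theorem measurePreserving_add_pi_uniformIcc {ι : Type*} [Fintype ι] (φ : ι → ℝ) :
    MeasurePreserving (fun x => φ + x) (Measure.pi fun _ => uniformIcc r)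
      (cond (volume : Measure (ι → ℝ)) (Set.Icc (fun i => φ i - r) (fun i => φ i + r))) := by
  have preimage_eq : (fun x => φ + x) ⁻¹' Set.Icc (fun i => φ i - r) (fun i => φ i + r) =
      Set.univ.pi fun _ => Set.Icc (-r) r := by
    rw [← Set.pi_univ_Icc]
    ext x
    simp only [Set.mem_preimage, Set.mem_univ_pi, Set.mem_Icc, Pi.add_apply, sub_eq_add_neg,
      add_le_add_iff_left]
  have h := measurePreserving_cond_preimage
    (measurePreserving_add_left (volume : Measure (ι → ℝ)) φ)
    (measurableSet_Icc (a := fun i => φ i - r) (b := fun i => φ i + r))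
  rwa [preimage_eq, volume_pi, cond_pi _ (fun _ => measurableSet_Icc) (by simp [hr]) (by simp)] at h

end UniformIcc

namespace VarProblem

variable {n m K : ℕ} (P : VarProblem n m K)

theorem patchVar_eq (θ : Fin m → ℝ) {r : ℝ} (hr : 0 < r) :
    P.patchVar θ r = Var[fun x => P.loss (θ + x); Measure.pi fun _ => uniformIcc r] :=
  ((measurePreserving_add_pi_uniformIcc hr θ).variance_fun_comp
    P.continuous_loss.aemeasurable).symm

/-- The denominator of `rStar ^ 2`. -/
noncomputable def rStarDenom : ℝ :=
  128 * ‖P.O‖ ^ 2 * P.maxFreq P.lastParam ^ 4 *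
    max (∑ j ∈ Finset.univ.erase P.lastParam, P.maxFreq j ^ 2) (P.maxFreq P.lastParam ^ 2 / 2)

section Uncorrelated

variable {P} (huncorr : ∀ l, P.S l = P.lastParam → l = Fin.last K) {θ : Fin m → ℝ}
include huncorr

theorem lossCurv_le (θ : Fin m → ℝ) :
    P.lossCurv θ ≤ ‖P.O‖ * P.maxFreq P.lastParam ^ 2 := by
  rw [maxFreq_lastParam huncorr, mul_comm]
  simpa using (le_abs_self _).trans ((P.bandLimited_lossCurv θ P.lastParam).norm_le 0)

theorem rStarDenom_pos (hθ : 0 < P.lossCurv θ) : 0 < P.rStarDenom := by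
  have hx := hθ.trans_le (lossCurv_le huncorr θ)
  have hO : 0 < ‖P.O‖ := pos_of_mul_pos_left hx (sq_nonneg _)
  have hω : 0 < P.maxFreq P.lastParam ^ 2 := pos_of_mul_pos_right hx (norm_nonneg _)
  have : 0 < max (∑ j ∈ Finset.univ.erase P.lastParam, P.maxFreq j ^ 2)
      (P.maxFreq P.lastParam ^ 2 / 2) := lt_max_of_lt_right (half_pos hω)
  rw [rStarDenom, show 4 = 2 * 2 from rfl, pow_mul]
  positivity

variable {B r : ℝ} (hB : 0 < B) (hθ : 2 * B ≤ P.lossCurv θ)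
  (hrB : r ^ 2 * P.rStarDenom ≤ 9 * B ^ 2)
include hB hθ hrB

theorem sq_mul_norm_mul_sq_mul_max_le :
    r ^ 2 * (‖P.O‖ * P.maxFreq P.lastParam ^ 2 *
      max (∑ j ∈ Finset.univ.erase P.lastParam, P.maxFreq j ^ 2)
        (P.maxFreq P.lastParam ^ 2 / 2)) ≤ 9 / 256 * B := by
  set x := ‖P.O‖ * P.maxFreq P.lastParam ^ 2 with hx
  set y := max (∑ j ∈ Finset.univ.erase P.lastParam, P.maxFreq j ^ 2)
    (P.maxFreq P.lastParam ^ 2 / 2) with hy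
  have hBx : 2 * B ≤ x := hθ.trans (lossCurv_le huncorr θ)
  refine le_of_mul_le_mul_left (a := 128 * x) ?_ (by linarith)
  calc 128 * x * (r ^ 2 * (x * y)) = r ^ 2 * P.rStarDenom := by rw [rStarDenom, ← hy, hx]; ring
    _ ≤ 9 * B ^ 2 := hrB
    _ ≤ 128 * x * (9 / 256 * B) := by linarith [mul_le_mul_of_nonneg_right hBx hB.le]

theorem le_covariance_sq_eval_loss (hr : 0 < r) :
    2 / 25 * B * r ^ 4 ≤
      cov[fun x => x P.lastParam ^ 2, fun x => P.loss (θ + x);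
        Measure.pi fun _ => uniformIcc r] := by
  have := isProbabilityMeasure_uniformIcc hr
  set w := P.maxFreq P.lastParam with hw
  set S := ∑ j ∈ Finset.univ.erase P.lastParam, P.maxFreq j ^ 2 with hS
  have hmax := sq_mul_norm_mul_sq_mul_max_le huncorr hB hθ hrB
  rw [← hw, ← hS] at hmax
  have drift_le : r ^ 2 * (‖P.O‖ * w ^ 2 * S) ≤ 9 / 256 * B :=
    (by gcongr; exact le_max_left _ _ : _ ≤ _).trans hmax
  have remainder_le : r ^ 2 * (‖P.O‖ * w ^ 2 * (w ^ 2 / 2)) ≤ 9 / 256 * B :=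
    (by gcongr; exact le_max_right _ _ : _ ≤ _).trans hmax
  have key := sub_le_covariance_sq_eval_of_second_difference_le (ae_mem_uniformIcc r)
    (L := fun x => P.loss (θ + x)) (F := fun x => P.lossCurv (θ + x))
    (P.continuous_loss.comp (continuous_const_add θ))
    (P.continuous_lossCurv.comp (continuous_const_add θ))
    (M := fun j => w ^ 2 * ‖P.O‖ * P.maxFreq j ^ 2) (fun j => by positivity)
    (C := ‖P.O‖ * w ^ 4 / 12) (by positivity) P.lastParam
    (fun x t => by
      simpa only [← add_assoc, Pi.single_zero, add_zero, iteratedDeriv_two_loss huncorr] using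
        (P.bandLimited_loss (θ + x) P.lastParam).abs_second_difference_sub_le t)
    (fun x j t => by
      simpa only [← add_assoc, Pi.single_zero, add_zero, ← maxFreq_lastParam huncorr] using
        (P.bandLimited_lossCurv (θ + x) j).abs_second_difference_le t)
  rw [variance_sq_uniformIcc hr, add_zero, ← Finset.mul_sum, ← hS] at key
  refine le_trans ?_ key
  calc 2 / 25 * B * r ^ 4
      ≤ r ^ 4 * (2 / 45 * (2 * B - 9 / 256 * B / 2) - 9 / 256 * B / 12) := by
        linarith [mul_pos hB (pow_pos hr 4)]
    _ ≤ r ^ 4 * (2 / 45 * (P.lossCurv θ - r ^ 2 * (‖P.O‖ * w ^ 2 * S) / 2) -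
          r ^ 2 * (‖P.O‖ * w ^ 2 * (w ^ 2 / 2)) / 12) := by gcongr
    _ = _ := by ring

theorem le_patchVar (hr : 0 < r) : B ^ 2 / 18 * r ^ 4 ≤ P.patchVar θ r := by
  have := isProbabilityMeasure_uniformIcc hr
  have memLp_two {f : (Fin m → ℝ) → ℝ} (hf : Continuous f) :
      MemLp f 2 (Measure.pi fun _ => uniformIcc r) :=
    (memLp_two_iff_integrable_sq hf.aestronglyMeasurable).2
      (integrable_pi_of_continuous (ae_mem_uniformIcc r) (hf.pow 2))
  have variance_eq : Var[fun x : Fin m → ℝ => x P.lastParam ^ 2;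
      Measure.pi fun _ => uniformIcc r] = 4 / 45 * r ^ 4 := by
    rw [← variance_sq_uniformIcc hr]
    exact (measurePreserving_eval (fun _ : Fin m => uniformIcc r) P.lastParam).variance_fun_comp
      (f := fun t : ℝ => t ^ 2) (by fun_prop)
  have covariance_ge := le_covariance_sq_eval_loss huncorr hB hθ hrB hr
  have cauchy_schwarz := sq_covariance_le
    (memLp_two (f := fun x => x P.lastParam ^ 2) (by fun_prop))
    (memLp_two (P.continuous_loss.comp (continuous_const_add θ)))
  rw [variance_eq] at cauchy_schwarz
  rw [P.patchVar_eq θ hr]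
  have := (pow_le_pow_left₀ (by positivity) covariance_ge 2).trans cauchy_schwarz
  refine le_of_mul_le_mul_left (a := 4 / 45 * r ^ 4) (le_trans ?_ this) (by positivity)
  linarith [mul_nonneg (sq_nonneg B) (pow_nonneg hr.le 8)]

end Uncorrelated

end VarProblem

namespace VarProblem

variable {n m K : ℕ} (P : VarProblem n m K)

theorem maxFreq_le_iSup (q : Fin m) : P.maxFreq q ≤ ⨆ q, P.maxFreq q :=
  le_ciSup (Set.finite_range _).bddAbove q

theorem iSup_maxFreq_nonneg : 0 ≤ ⨆ q, P.maxFreq q := Real.iSup_nonneg P.maxFreq_nonneg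

include P in
theorem one_le_numParams : (1 : ℝ) ≤ m := by exact_mod_cast Fin.pos P.lastParam

theorem rStarDenom_le : P.rStarDenom ≤ 128 * (‖P.O‖ ^ 2 * (⨆ q, P.maxFreq q) ^ 6) * m := by
  set W := ⨆ q, P.maxFreq q
  have sq_le : ∀ q, P.maxFreq q ^ 2 ≤ W ^ 2 := fun q =>
    pow_le_pow_left₀ (P.maxFreq_nonneg q) (P.maxFreq_le_iSup q) 2
  have sum_le : ∑ j ∈ Finset.univ.erase P.lastParam, P.maxFreq j ^ 2 ≤ m * W ^ 2 :=
    calc ∑ j ∈ Finset.univ.erase P.lastParam, P.maxFreq j ^ 2 ≤ ∑ j, P.maxFreq j ^ 2 :=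
          Finset.sum_le_sum_of_subset_of_nonneg (Finset.erase_subset _ _) fun _ _ _ => sq_nonneg _
      _ ≤ ∑ _ : Fin m, W ^ 2 := Finset.sum_le_sum fun q _ => sq_le q
      _ = m * W ^ 2 := by rw [Finset.sum_const, Finset.card_fin, nsmul_eq_mul]
  have half_sq_le : P.maxFreq P.lastParam ^ 2 / 2 ≤ m * W ^ 2 := by
    linarith [sq_le P.lastParam, sq_nonneg W,
      mul_le_mul_of_nonneg_right P.one_le_numParams (sq_nonneg W)]
  have fourth_le := pow_le_pow_left₀ (P.maxFreq_nonneg _) (P.maxFreq_le_iSup P.lastParam) 4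
  calc P.rStarDenom ≤ 128 * ‖P.O‖ ^ 2 * W ^ 4 * (m * W ^ 2) :=
        mul_le_mul (by gcongr) (max_le sum_le half_sq_le)
          (le_max_of_le_right (by positivity)) (by positivity)
    _ = 128 * (‖P.O‖ ^ 2 * W ^ 6) * m := by ring

/-- The output state at `θ` is within the threshold of the ground state of the observable, and the
parameter of the last generator drives no other generator. -/
structure NearGround (E : EigenDecomp P.O) (θ : Fin m → ℝ) (ε : ℂ) : Prop where
  fidelity : (P.evolved θ * E.groundProj).trace = ((1 - ‖ε‖ ^ 2 : ℝ) : ℂ)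
  uncorrelated : ∀ l, P.S l = P.lastParam → l = Fin.last K
  small : ‖ε‖ < P.threshold E

variable {P} {E : EigenDecomp P.O} {θ : Fin m → ℝ} {ε : ℂ}

theorem GoodMinimum.nearGround (h : P.GoodMinimum E θ ε) : P.NearGround E θ ε :=
  ⟨h.fidelity, h.uncorrelated, h.small⟩

namespace NearGround

variable (h : P.NearGround E θ ε)
include h

theorem denom_pos : 0 < (6 * ‖P.O‖ + 11 * E.gap) * ‖P.lastH‖ ^ 2 := by
  have threshold_pos : 0 < P.threshold E := (norm_nonneg ε).trans_lt h.small
  have gap_nonneg := E.gap_nonneg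
  refine lt_of_le_of_ne (by positivity) fun hzero => ?_
  rw [threshold, ← hzero, div_zero] at threshold_pos
  exact threshold_pos.false

theorem norm_mul_denom_lt :
    ‖ε‖ * ((6 * ‖P.O‖ + 11 * E.gap) * ‖P.lastH‖ ^ 2) < E.gap * P.stateVar :=
  (lt_div_iff₀ h.denom_pos).1 h.small

theorem gap_mul_stateVar_pos : 0 < E.gap * P.stateVar :=
  (mul_nonneg (norm_nonneg ε) h.denom_pos.le).trans_lt h.norm_mul_denom_lt

theorem curv_pos : 0 < P.curv E ε := by
  rw [curv]
  linarith [h.norm_mul_denom_lt]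

theorem mul_gap_mul_stateVar_le_curv {δ : ℝ} (hε : ‖ε‖ ≤ (1 - δ) * P.threshold E) :
    δ * (E.gap * P.stateVar) ≤ P.curv E ε := by
  rw [threshold, ← mul_div_assoc, le_div_iff₀ h.denom_pos] at hε
  rw [curv]
  linarith

theorem two_mul_curv_le_lossCurv : 2 * P.curv E ε ≤ P.lossCurv θ := by
  refine le_trans ?_ (P.le_lossCurv E θ (norm_nonneg ε) h.fidelity)
  have gap_nonneg := E.gap_nonneg
  rw [curv]
  gcongr <;> linarith [norm_nonneg P.O]

-- The error term `8 gap + 2 ‖O‖` of `le_lossCurv` is at most `8 / 11` of `11 gap + 6 ‖O‖`.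
theorem two_mul_gap_mul_stateVar_le_lossCurv :
    2 * (3 / 11 * (E.gap * P.stateVar)) ≤ P.lossCurv θ := by
  refine le_trans ?_ (P.le_lossCurv E θ (norm_nonneg ε) h.fidelity)
  have hO : 0 ≤ ‖ε‖ * ‖P.lastH‖ ^ 2 * ‖P.O‖ := by positivity
  linarith [h.norm_mul_denom_lt]

theorem rStarDenom_pos : 0 < P.rStarDenom :=
  VarProblem.rStarDenom_pos h.uncorrelated <|
    (mul_pos two_pos h.curv_pos).trans_le h.two_mul_curv_le_lossCurv

theorem rStar_pos : 0 < P.rStar E ε :=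
  Real.sqrt_pos.2 (div_pos (mul_pos (by norm_num) (pow_pos h.curv_pos 2)) h.rStarDenom_pos)

theorem le_rStar_iff {r : ℝ} (hr : 0 < r) :
    r ≤ P.rStar E ε ↔ r ^ 2 * P.rStarDenom ≤ 9 * P.curv E ε ^ 2 :=
  (Real.le_sqrt' hr).trans (le_div_iff₀ h.rStarDenom_pos)

theorem le_patchVar_of_le_rStar {r : ℝ} (hr : 0 < r) (hle : r ≤ P.rStar E ε) :
    P.curv E ε ^ 2 / 18 * r ^ 4 ≤ P.patchVar θ r :=
  le_patchVar h.uncorrelated h.curv_pos h.two_mul_curv_le_lossCurv ((h.le_rStar_iff hr).1 hle) hr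

theorem le_patchVar_of_sq_mul_rStarDenom_le {r : ℝ} (hr : 0 < r)
    (hle : r ^ 2 * P.rStarDenom ≤ 9 * (3 / 11 * (E.gap * P.stateVar)) ^ 2) :
    (3 / 11 * (E.gap * P.stateVar)) ^ 2 / 18 * r ^ 4 ≤ P.patchVar θ r :=
  le_patchVar h.uncorrelated (mul_pos (by norm_num) h.gap_mul_stateVar_pos)
    h.two_mul_gap_mul_stateVar_le_lossCurv hle hr

end NearGround

end VarProblem

namespace InOPoly

variable {f g : ℕ → ℝ}

theorem const (c : ℝ) : InOPoly fun _ => c :=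
  ⟨|c| + 1, by positivity, 0, .of_forall fun _ => by linarith [le_abs_self c, pow_zero (1 : ℝ)]⟩

theorem mono (hg : InOPoly g) (hfg : ∀ᶠ n in atTop, f n ≤ g n) : InOPoly f := by
  obtain ⟨c, hc, k, hle⟩ := hg
  exact ⟨c, hc, k, hfg.mp (hle.mono fun n hgn hfn => hfn.trans hgn)⟩

theorem mul (hf : InOPoly f) (hg : InOPoly g) (hg₀ : ∀ n, 0 ≤ g n) :
    InOPoly fun n => f n * g n := by
  obtain ⟨c, hc, k, hfle⟩ := hf
  obtain ⟨d, hd, l, hgle⟩ := hg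
  refine ⟨c * d, mul_pos hc hd, k + l, ?_⟩
  filter_upwards [hfle, hgle] with n hfn hgn
  calc f n * g n ≤ c * n ^ k * (d * n ^ l) := mul_le_mul hfn hgn (hg₀ n) (by positivity)
    _ = c * d * n ^ (k + l) := by ring

theorem pow (hf : InOPoly f) (hf₀ : ∀ n, 0 ≤ f n) (k : ℕ) : InOPoly fun n => f n ^ k := by
  induction k with
  | zero => simpa only [pow_zero] using const 1
  | succ k ih => simpa only [pow_succ] using ih.mul hf hf₀

end InOPoly

namespace InOmegaInvPoly

variable {f g : ℕ → ℝ}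

theorem const {c : ℝ} (hc : 0 < c) : InOmegaInvPoly (fun _ => 1) fun _ => c :=
  ⟨c, hc, 0, .of_forall fun n => by simp⟩

theorem mono (hf : InOmegaInvPoly g f) {f' : ℕ → ℝ} (h : ∀ᶠ n in atTop, f n ≤ f' n) :
    InOmegaInvPoly g f' := by
  obtain ⟨c, hc, k, hle⟩ := hf
  exact ⟨c, hc, k, h.mp (hle.mono fun n => le_trans)⟩

theorem mul {f' : ℕ → ℝ} (hf : InOmegaInvPoly (fun _ => 1) f)
    (hf' : InOmegaInvPoly (fun _ => 1) f') : InOmegaInvPoly (fun _ => 1) fun n => f n * f' n := by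
  obtain ⟨c, hc, k, hle⟩ := hf
  obtain ⟨d, hd, l, hle'⟩ := hf'
  refine ⟨c * d, mul_pos hc hd, k + l, ?_⟩
  simp only [one_mul] at hle hle' ⊢
  filter_upwards [hle, hle'] with n h h'
  rw [pow_add, mul_div_mul_comm]
  exact mul_le_mul h h' (by positivity) (le_trans (by positivity) h)

theorem pow (hf : InOmegaInvPoly (fun _ => 1) f) (k : ℕ) :
    InOmegaInvPoly (fun _ => 1) fun n => f n ^ k := by
  induction k with
  | zero => simpa only [pow_zero] using const one_pos
  | succ k ih => simpa only [pow_succ] using ih.mul hf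

theorem of_one (hf : InOmegaInvPoly (fun _ => 1) f) (hg : ∀ n, 1 ≤ g n) : InOmegaInvPoly g f := by
  obtain ⟨c, hc, k, hle⟩ := hf
  refine ⟨c, hc, k, ?_⟩
  filter_upwards [hle, eventually_gt_atTop 0] with n h hn
  refine le_trans ?_ h
  have := hg n
  gcongr

theorem to_one (hf : InOmegaInvPoly g f) (hg : InOPoly g) (hg₀ : ∀ n, 0 < g n) :
    InOmegaInvPoly (fun _ => 1) f := by
  obtain ⟨c, hc, k, hfle⟩ := hf
  obtain ⟨d, hd, l, hgle⟩ := hg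
  refine ⟨c / d, div_pos hc hd, k + l, ?_⟩
  filter_upwards [hfle, hgle, eventually_gt_atTop 0] with n hfn hgn hn
  have := hg₀ n
  calc c / d / (1 * (n : ℝ) ^ (k + l)) = c / (d * n ^ l * n ^ k) := by
        rw [div_div, one_mul, mul_assoc, ← pow_add, add_comm]
    _ ≤ c / (g n * n ^ k) := by gcongr
    _ ≤ f n := hfn

theorem exists_eventually_sq_mul_le {D F : ℕ → ℝ} (hF : InOmegaInvPoly (fun _ => 1) F)
    (hD : InOPoly D) (hg : ∀ n, 0 < g n) : ∃ a : ℝ, 0 < a ∧ ∃ k : ℕ, ∀ᶠ n : ℕ in atTop,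
      (a / (√(g n) * (n : ℝ) ^ k)) ^ 2 * (D n * g n) ≤ F n := by
  obtain ⟨b, hb, s, hFle⟩ := hF
  obtain ⟨c, hc, d, hDle⟩ := hD
  refine ⟨√(b / c), Real.sqrt_pos.2 (div_pos hb hc), d + s, ?_⟩
  filter_upwards [hFle, hDle, eventually_ge_atTop 1] with n hFn hDn hn
  have hgn := hg n
  have hn₁ : (1 : ℝ) ≤ n := by exact_mod_cast hn
  have : (0 : ℝ) < n := by linarith
  calc (√(b / c) / (√(g n) * (n : ℝ) ^ (d + s))) ^ 2 * (D n * g n)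
      = b / c / (n : ℝ) ^ (2 * (d + s)) * D n := by
        rw [div_pow, mul_pow, Real.sq_sqrt (div_pos hb hc).le, Real.sq_sqrt hgn.le, ← pow_mul,
          mul_comm (d + s)]
        field_simp
    _ ≤ b / c / (n : ℝ) ^ (d + s) / (n : ℝ) ^ (d + s) * (c * n ^ d) := by
        rw [two_mul, pow_add _ (d + s), ← div_div]
        gcongr
    _ = b / (1 * n ^ s) / (n : ℝ) ^ (d + s) := by field_simp; ring
    _ ≤ b / (1 * n ^ s) := div_le_self (by positivity) (one_le_pow₀ hn₁)
    _ ≤ F n := hFn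

end InOmegaInvPoly

section Scaling

variable {m K : ℕ → ℕ} {P : ∀ n, VarProblem n (m n) (K n)} {B r : ℕ → ℝ}

theorem exists_eventually_sq_mul_rStarDenom_le (hO : InOPoly fun n => ‖(P n).O‖)
    (hW : InOPoly fun n => ⨆ q, (P n).maxFreq q) (hB : InOmegaInvPoly (fun _ => 1) B) :
    ∃ a : ℝ, 0 < a ∧ ∃ k : ℕ, ∀ᶠ n : ℕ in atTop,
      (a / (√(m n : ℝ) * (n : ℝ) ^ k)) ^ 2 * (P n).rStarDenom ≤ 9 * B n ^ 2 := by
  have hD := (InOPoly.const 128).mul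
    ((hO.pow (fun n => norm_nonneg _) 2).mul (hW.pow (fun n => (P n).iSup_maxFreq_nonneg) 6)
      fun n => pow_nonneg (P n).iSup_maxFreq_nonneg 6)
    fun n => mul_nonneg (sq_nonneg _) (pow_nonneg (P n).iSup_maxFreq_nonneg 6)
  have hF := (InOmegaInvPoly.const (by norm_num : (0 : ℝ) < 9)).mul (hB.pow 2)
  obtain ⟨a, ha, k, hle⟩ := hF.exists_eventually_sq_mul_le hD (g := fun n => m n)
    fun n => one_pos.trans_le (P n).one_le_numParams
  exact ⟨a, ha, k, hle.mono fun n h =>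
    (mul_le_mul_of_nonneg_left (P n).rStarDenom_le (sq_nonneg _)).trans h⟩

theorem inOmegaInvPoly_patchVar {θ : ∀ n, Fin (m n) → ℝ} (hm : InOPoly fun n => (m n : ℝ))
    (hB : InOmegaInvPoly (fun _ => 1) B) (hr : InOmegaInvPoly (fun n => √(m n : ℝ)) r)
    (h : ∀ᶠ n in atTop, B n ^ 2 / 18 * r n ^ 4 ≤ (P n).patchVar (θ n) (r n)) :
    InOmegaInvPoly (fun n => √(m n : ℝ)) fun n => (P n).patchVar (θ n) (r n) := by
  have one_le_sqrt : ∀ n, 1 ≤ √(m n : ℝ) := fun n => Real.one_le_sqrt.2 (P n).one_le_numParams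
  have hsqrt : InOPoly fun n => √(m n : ℝ) := hm.mono <| .of_forall fun n =>
    Real.sqrt_le_self_iff.2 <| .inr (P n).one_le_numParams
  have hr₁ := hr.to_one hsqrt fun n => one_pos.trans_le (one_le_sqrt n)
  have hBr := ((hB.pow 2).mul (InOmegaInvPoly.const (by norm_num : (0 : ℝ) < 18⁻¹))).mul (hr₁.pow 4)
  exact (hBr.mono h).of_one one_le_sqrt

variable {E : ∀ n, EigenDecomp (P n).O} {θ : ∀ n, Fin (m n) → ℝ} {ε : ℕ → ℂ}
  (hnear : ∀ᶠ n in atTop, (P n).NearGround (E n) (θ n) (ε n))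
include hnear

theorem exists_inOmegaInvPoly_patchVar
    (hprod : InOmegaInvPoly (fun _ => 1) fun n => (E n).gap * (P n).stateVar)
    (hO : InOPoly fun n => ‖(P n).O‖) (hW : InOPoly fun n => ⨆ q, (P n).maxFreq q) :
    ∃ a : ℝ, 0 < a ∧ ∃ k : ℕ, InOPoly (fun n => (m n : ℝ)) →
      InOmegaInvPoly (fun n => √(m n : ℝ))
        (fun n => (P n).patchVar (θ n) (a / (√(m n : ℝ) * (n : ℝ) ^ k))) := by
  have hB := (InOmegaInvPoly.const (by norm_num : (0 : ℝ) < 3 / 11)).mul hprod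
  obtain ⟨a, ha, k, hle⟩ := exists_eventually_sq_mul_rStarDenom_le hO hW hB
  refine ⟨a, ha, k, fun hm =>
    inOmegaInvPoly_patchVar hm hB ⟨a, ha, k, .of_forall fun n => le_rfl⟩ ?_⟩
  filter_upwards [hnear, hle, eventually_gt_atTop 0] with n h hle hn
  have := (P n).one_le_numParams
  exact h.le_patchVar_of_sq_mul_rStarDenom_le (by positivity) hle

theorem inOmegaInvPoly_rStar (hO : InOPoly fun n => ‖(P n).O‖)
    (hW : InOPoly fun n => ⨆ q, (P n).maxFreq q)
    (hcurv : InOmegaInvPoly (fun _ => 1) fun n => (P n).curv (E n) (ε n)) :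
    InOmegaInvPoly (fun n => √(m n : ℝ)) fun n => (P n).rStar (E n) (ε n) := by
  obtain ⟨a, ha, k, hle⟩ := exists_eventually_sq_mul_rStarDenom_le hO hW hcurv
  refine ⟨a, ha, k, ?_⟩
  filter_upwards [hnear, hle, eventually_gt_atTop 0] with n h hle hn
  have := (P n).one_le_numParams
  exact (h.le_rStar_iff (by positivity)).2 hle

theorem inOmegaInvPoly_curv {δ : ℕ → ℝ} (hδ : InOmegaInvPoly (fun _ => 1) δ)
    (hprod : InOmegaInvPoly (fun _ => 1) fun n => (E n).gap * (P n).stateVar)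
    (hε : ∀ᶠ n in atTop, ‖ε n‖ ≤ (1 - δ n) * (P n).threshold (E n)) :
    InOmegaInvPoly (fun _ => 1) fun n => (P n).curv (E n) (ε n) :=
  (hδ.mul hprod).mono (hnear.mp (hε.mono fun _ hεn h => h.mul_gap_mul_stateVar_le_curv hεn))

end Scaling

theorem corollary1_general :
    (∀ (n m K : ℕ) (P : VarProblem n m K) (E : EigenDecomp P.O) (θ : Fin m → ℝ) (ε : ℂ),
      P.NearGround E θ ε →
        0 < P.curv E ε ∧ 0 < P.rStar E ε ∧
        ∀ r : ℝ, 0 < r → r ≤ P.rStar E ε →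
          P.curv E ε ^ 2 / 18 * r ^ 4 ≤ P.patchVar θ r) ∧
    (∀ (m K : ℕ → ℕ) (P : ∀ n, VarProblem n (m n) (K n)) (E : ∀ n, EigenDecomp (P n).O)
      (θ : ∀ n, Fin (m n) → ℝ) (ε : ℕ → ℂ),
      (∀ᶠ n in Filter.atTop, (P n).NearGround (E n) (θ n) (ε n)) →
      InOmegaInvPoly (fun _ => 1) (fun n => (E n).gap) →
      InOmegaInvPoly (fun _ => 1) (fun n => (P n).stateVar) →
      InOPoly (fun n => ‖(P n).O‖) →
      InOPoly (fun n => ⨆ q, (P n).maxFreq q) →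
        (∃ a : ℝ, 0 < a ∧ ∃ k : ℕ,
          InOPoly (fun n => (m n : ℝ)) →
            InOmegaInvPoly (fun n => √(m n : ℝ))
              (fun n => (P n).patchVar (θ n) (a / (√(m n : ℝ) * (n : ℝ) ^ k)))) ∧
        (∀ δ : ℕ → ℝ, InOmegaInvPoly (fun _ => 1) δ →
          (∀ᶠ n in Filter.atTop, ‖ε n‖ ≤ (1 - δ n) * (P n).threshold (E n)) →
            InOmegaInvPoly (fun n => √(m n : ℝ)) (fun n => (P n).rStar (E n) (ε n)) ∧
            (InOPoly (fun n => (m n : ℝ)) →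
              InOmegaInvPoly (fun n => √(m n : ℝ))
                (fun n => (P n).patchVar (θ n) ((P n).rStar (E n) (ε n)))))) := by
  refine ⟨fun n m K P E θ ε h => ⟨h.curv_pos, h.rStar_pos, fun r hr hle =>
    h.le_patchVar_of_le_rStar hr hle⟩, ?_⟩
  intro m K P E θ ε hnear hgap hvar hO hW
  refine ⟨exists_inOmegaInvPoly_patchVar hnear (hgap.mul hvar) hO hW, fun δ hδ hε => ?_⟩
  have hcurv := inOmegaInvPoly_curv hnear hδ (hgap.mul hvar) hε
  have hrStar := inOmegaInvPoly_rStar hnear hO hW hcurv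
  exact ⟨hrStar, fun hm => inOmegaInvPoly_patchVar hm hcurv hrStar <| hnear.mono fun n h =>
    h.le_patchVar_of_le_rStar h.rStar_pos le_rfl⟩

theorem corollary1 :
    -- the variance bound on the explicit patch
    (∀ (n m K : ℕ) (P : VarProblem n m K) (E : EigenDecomp P.O) (θ : Fin m → ℝ) (ε : ℂ),
      P.GoodMinimum E θ ε →
        0 < P.curv E ε ∧ 0 < P.rStar E ε ∧
        ∀ r : ℝ, 0 < r → r ≤ P.rStar E ε →
          P.curv E ε ^ 2 / 18 * r ^ 4 ≤ P.patchVar θ r) ∧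
    -- the scaling with the number of qubits
    (∀ (m K : ℕ → ℕ) (P : ∀ n, VarProblem n (m n) (K n)) (E : ∀ n, EigenDecomp (P n).O)
      (θ : ∀ n, Fin (m n) → ℝ) (ε : ℕ → ℂ),
      (∀ᶠ n in Filter.atTop, (P n).GoodMinimum (E n) (θ n) (ε n)) →
      InOmegaInvPoly (fun _ => 1) (fun n => (E n).gap) →
      InOmegaInvPoly (fun _ => 1) (fun n => (P n).stateVar) →
      InOPoly (fun n => ‖(P n).O‖) →
      InOPoly (fun n => ⨆ q, (P n).maxFreq q) →
        -- some patch of half-width of exact order `1 / (√m poly(n))`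
        (∃ a : ℝ, 0 < a ∧ ∃ k : ℕ,
          InOPoly (fun n => (m n : ℝ)) →
            InOmegaInvPoly (fun n => √(m n : ℝ))
              (fun n => (P n).patchVar (θ n) (a / (√(m n : ℝ) * (n : ℝ) ^ k)))) ∧
        -- the explicit patch, if `|ε|` is below the threshold by an inverse polynomial factor
        (∀ δ : ℕ → ℝ, InOmegaInvPoly (fun _ => 1) δ →
          (∀ᶠ n in Filter.atTop, ‖ε n‖ ≤ (1 - δ n) * (P n).threshold (E n)) →
            InOmegaInvPoly (fun n => √(m n : ℝ)) (fun n => (P n).rStar (E n) (ε n)) ∧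
            (InOPoly (fun n => (m n : ℝ)) →
              InOmegaInvPoly (fun n => √(m n : ℝ))
                (fun n => (P n).patchVar (θ n) ((P n).rStar (E n) (ε n)))))) := by
  exact ⟨fun n m K P E θ ε h => corollary1_general.1 n m K P E θ ε h.nearGround,
    fun m K P E θ ε h => corollary1_general.2 m K P E θ ε (h.mono fun _ => (·.nearGround))⟩
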